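/- Let $p,Q\ge 1$ and let $n_0,\dots,n_Q$ be sample sizes. For $k=0,\dots,Q$ observe $y^{(k)} = X^{(k)}\beta^{(k)}+\varepsilon^{(k)}$, where $\beta^{(k)}\in\mathbb{R}^p$ is fixed, $X^{(k)}\in\mathbb{R}^{n_k\times p}$ is a random design, and $\varepsilon^{(k)}\in\mathbb{R}^{n_k}$ has i.i.d. components with mean $0$ and finite variance $\sigma_k^2$; all designs $\mathcal{X}=\{X^{(k)}\}_k$ and noises $\{\varepsilon^{(k)}\}_k$ are mutually independent. The task $k=0$ is the target; fix a source $q\in\{1,\dots,Q\}$ and put $\delta^{(q)}=\beta^{(q)}-\beta^{(0)}$. Assume that $X^{(0)}$ and $X^{(q)}$ have i.i.d. standard Gaussian entries (identity covariance), with $p>n_0+1$ and $p>n_q+1$. Define the minimum-$\ell_2$-norm interpolators (MNI) $\hat\beta_M^{(k)}=\arg\min\{\|\beta\| : X^{(k)}\beta=y^{(k)}\}$ and the Transfer MNI $\hat\beta_{TM}^{(q)}=\arg\min\{\|\beta-\hat\beta_M^{(q)}\| : X^{(0)}\beta=y^{(0)}\}$, which exist and are unique almost surely for $k\in\{0,q\}$.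 For an estimator $\hat\beta$ the (squared) bias and the variance conditional on the designs are $\mathcal{B}=\|\mathbb{E}[\hat\beta\mid\mathcal{X}]-\beta^{(0)}\|^2$ and $\mathcal{V}=\mathrm{Tr}\,\mathrm{Cov}(\hat\beta\mid\mathcal{X})$; write $\mathcal{B}_M^{(0)},\mathcal{V}_M^{(0)}$ for $\hat\beta_M^{(0)}$ and $\mathcal{B}_{TM}^{(q)},\mathcal{V}_{TM}^{(q)}$ for $\hat\beta_{TM}^{(q)}$. Let $H^{(k)}=X^{(k)\top}(X^{(k)}X^{(k)\top})^\dagger X^{(k)}$, $\Pi^{(0)}=(I_p-H^{(0)})I_p(I_p-H^{(0)})$, $\hat\Sigma^{(k)}=\frac1{n_k}X^{(k)\top}X^{(k)}$, where $\dagger$ is the Moore–Penrose inverse, and define the variance inflation $\mathcal{V}_\uparrow^{(q)}=\frac{\sigma_q^2}{n_q}\mathrm{Tr}(\hat\Sigma^{(q)\dagger}\Pi^{(0)})$ (terms with a factor $1/n_k$ are read as $0$ when $n_k=0$). Then almost surely $$\mathcal{B}_M^{(0)}=\beta^{(0)\top}\Pi^{(0)}\beta^{(0)},\qquad \mathcal{V}_M^{(0)}=\frac{\sigma_0^2}{n_0}\mathrm{Tr}\big(\hat\Sigma^{(0)\dagger}\big),\qquad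 \mathcal{V}_{TM}^{(q)}=\mathcal{V}_\uparrow^{(q)}+\mathcal{V}_M^{(0)},$$ $$\mathcal{B}_{TM}^{(q)}=\beta^{(0)\top}(I_p-H^{(q)})\Pi^{(0)}(I_p-H^{(q)})\beta^{(0)}+\delta^{(q)\top}H^{(q)}\Pi^{(0)}H^{(q)}\delta^{(q)}-2\,\delta^{(q)\top}H^{(q)}\Pi^{(0)}(I_p-H^{(q)})\beta^{(0)},$$ all of $\mathcal{B}_M^{(0)},\mathcal{B}_{TM}^{(q)},\mathcal{V}_M^{(0)},\mathcal{V}_\uparrow^{(q)},\mathcal{V}_{TM}^{(q)}$ are integrable, and their expectations over the designs are $$\mathbb{E}\,\mathcal{B}_M^{(0)}=\frac{p-n_0}{p}\|\beta^{(0)}\|^2,\qquad \mathbb{E}\,\mathcal{B}_{TM}^{(q)}=\frac{p-n_0}{p}\Big(\frac{p-n_q}{p}\|\beta^{(0)}\|^2+\frac{n_q}{p}\|\delta^{(q)}\|^2\Big),$$ $$\mathbb{E}\,\mathcal{V}_M^{(0)}=\frac{\sigma_0^2n_0}{p-(n_0+1)},\qquad \mathbb{E}\,\mathcal{V}_\uparrow^{(q)}=\frac{p-n_0}{p}\cdot\frac{\sigma_q^2n_q}{p-(n_q+1)},\qquad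 \mathbb{E}\,\mathcal{V}_{TM}^{(q)}=\mathbb{E}\,\mathcal{V}_\uparrow^{(q)}+\mathbb{E}\,\mathcal{V}_M^{(0)}.$$ -/

import Mathlib

open MeasureTheory ProbabilityTheory
open scoped Matrix

noncomputable section

namespace TransferMNI

/-! ### Moore–Penrose inverse -/

/-- The four Penrose conditions: `P` is a Moore–Penrose inverse of the real matrix `A`. -/
structure IsMoorePenrose {m n : ℕ} (A : Matrix (Fin m) (Fin n) ℝ) (P : Matrix (Fin n) (Fin m) ℝ) :
    Prop where
  mul_mul_self : A * P * A = A
  self_mul_mul : P * A * P = P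
  symm_left : (A * P)ᵀ = A * P
  symm_right : (P * A)ᵀ = P * A

theorem IsMoorePenrose.unique {m n : ℕ} {A : Matrix (Fin m) (Fin n) ℝ}
    {P R : Matrix (Fin n) (Fin m) ℝ} (hP : IsMoorePenrose A P) (hR : IsMoorePenrose A R) :
    P = R := by
  have h1 : A * P = A * R := by
    calc A * P = (A * P)ᵀ := hP.symm_left.symm
      _ = ((A * R) * (A * P))ᵀ := by
          rw [← Matrix.mul_assoc (A * R), hR.mul_mul_self]
      _ = (A * P)ᵀ * (A * R)ᵀ := Matrix.transpose_mul _ _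
      _ = (A * P) * (A * R) := by rw [hP.symm_left, hR.symm_left]
      _ = A * R := by rw [← Matrix.mul_assoc (A * P), hP.mul_mul_self]
  have h2 : P * A = R * A := by
    calc P * A = (P * A)ᵀ := hP.symm_right.symm
      _ = ((P * A) * (R * A))ᵀ := by
          rw [Matrix.mul_assoc, ← Matrix.mul_assoc A, hR.mul_mul_self]
      _ = (R * A)ᵀ * (P * A)ᵀ := Matrix.transpose_mul _ _
      _ = (R * A) * (P * A) := by rw [hP.symm_right, hR.symm_right]
      _ = R * A := by rw [Matrix.mul_assoc, ← Matrix.mul_assoc A, hP.mul_mul_self]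
  calc P = P * A * P := hP.self_mul_mul.symm
    _ = R * A * R := by rw [h2, Matrix.mul_assoc, h1, ← Matrix.mul_assoc]
    _ = R := hR.self_mul_mul

theorem exists_isMoorePenrose {m n : ℕ} (A : Matrix (Fin m) (Fin n) ℝ) :
    ∃ P, IsMoorePenrose A P := by
  have hM : (Aᵀ * A).IsHermitian := by
    simp [Matrix.IsHermitian, Matrix.conjTranspose_eq_transpose_of_trivial]
  set M := Aᵀ * A with hMdef
  obtain ⟨G, hMGM, hGMG, hG, hGM⟩ : ∃ G : Matrix (Fin n) (Fin n) ℝ,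
      M * G * M = M ∧ G * M * G = G ∧ Gᵀ = G ∧ (G * M)ᵀ = G * M := by
    set U : Matrix (Fin n) (Fin n) ℝ := hM.eigenvectorUnitary.1 with hU
    set D := Matrix.diagonal hM.eigenvalues with hD
    set E := Matrix.diagonal (fun i => (hM.eigenvalues i)⁻¹) with hE
    have hUU : Uᵀ * U = 1 := by
      have := Unitary.coe_star_mul_self hM.eigenvectorUnitary
      simpa [Matrix.star_eq_conjTranspose, Matrix.conjTranspose_eq_transpose_of_trivial] using this
    have hMs : M = U * D * Uᵀ := by
      have h := hM.spectral_theorem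
      rw [Unitary.conjStarAlgAut_apply] at h
      simpa [Matrix.star_eq_conjTranspose, Matrix.conjTranspose_eq_transpose_of_trivial,
        Function.comp_def] using h
    have key : ∀ B C : Matrix (Fin n) (Fin n) ℝ,
        (U * B * Uᵀ) * (U * C * Uᵀ) = U * (B * C) * Uᵀ := by
      intro B C
      calc (U * B * Uᵀ) * (U * C * Uᵀ) = U * B * (Uᵀ * U) * C * Uᵀ := by
            simp only [Matrix.mul_assoc]
        _ = U * (B * C) * Uᵀ := by rw [hUU]; simp only [Matrix.mul_assoc, Matrix.one_mul]
    have hDED : D * E * D = D := by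
      simp only [hD, hE, Matrix.diagonal_mul_diagonal]
      congr 1; ext i
      by_cases h : hM.eigenvalues i = 0 <;> simp [h]
    have hEDE : E * D * E = E := by
      simp only [hD, hE, Matrix.diagonal_mul_diagonal]
      congr 1; ext i
      by_cases h : hM.eigenvalues i = 0 <;> simp [h]
    refine ⟨U * E * Uᵀ, ?_, ?_, ?_, ?_⟩
    · rw [hMs, key, key, hDED]
    · rw [hMs, key, key, hEDE]
    · simp [hE, Matrix.transpose_mul, Matrix.mul_assoc]
    · rw [hMs, key]
      simp [hD, hE, Matrix.transpose_mul, Matrix.mul_assoc, Matrix.diagonal_mul_diagonal]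
  have hMT : Mᵀ = M := by simp [hMdef, Matrix.transpose_mul]
  have hAGM : A * G * M = A := by
    have hz : (A * G * M - A)ᵀ * (A * G * M - A) = 0 := by
      have e1 : Aᵀ * (A * G * M - A) = 0 := by
        calc Aᵀ * (A * G * M - A) = Aᵀ * A * G * M - Aᵀ * A := by
              rw [Matrix.mul_sub]; simp only [Matrix.mul_assoc]
          _ = 0 := by rw [← hMdef, hMGM, sub_self]
      have e2 : (A * G * M - A)ᵀ = (M * G - 1) * Aᵀ := by
        simp [Matrix.transpose_sub, Matrix.transpose_mul, hG, hMT, Matrix.sub_mul,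
          Matrix.mul_assoc]
      rw [e2, Matrix.mul_assoc, e1, Matrix.mul_zero]
    have := (Matrix.conjTranspose_mul_self_eq_zero (A := A * G * M - A)).1 (by
      rw [Matrix.conjTranspose_eq_transpose_of_trivial]; exact hz)
    exact sub_eq_zero.1 this
  refine ⟨G * Aᵀ, ⟨?_, ?_, ?_, ?_⟩⟩
  · rw [Matrix.mul_assoc, Matrix.mul_assoc G, ← hMdef, ← Matrix.mul_assoc, hAGM]
  · calc G * Aᵀ * A * (G * Aᵀ) = G * (Aᵀ * A) * G * Aᵀ := by simp only [Matrix.mul_assoc]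
      _ = G * Aᵀ := by rw [← hMdef, hGMG]
  · simp [Matrix.transpose_mul, hG, Matrix.mul_assoc]
  · rw [Matrix.mul_assoc, ← hMdef, hGM]

/-- The Moore–Penrose inverse `A†` of a real matrix (the unique matrix satisfying the four
Penrose conditions). -/
def pinv {m n : ℕ} (A : Matrix (Fin m) (Fin n) ℝ) : Matrix (Fin n) (Fin m) ℝ :=
  (exists_isMoorePenrose A).choose

/-! ### Interpolators -/

/-- The set of interpolators of a data set: all `β` with `X β = y`. -/
def interpolators {n p : ℕ} (X : Matrix (Fin n) (Fin p) ℝ) (y : Fin n → ℝ) :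
    Set (EuclideanSpace ℝ (Fin p)) :=
  {β | X *ᵥ β.ofLp = y}

open Classical in
/-- The interpolator of `(X, y)` at minimal Euclidean distance from `b`, i.e.
`argmin {‖β - b‖ : X β = y}`. It is the unique minimizer whenever some interpolator exists
(in particular if `X` has full row rank), and `0` by convention otherwise. -/
def nearestInterpolator {n p : ℕ} (X : Matrix (Fin n) (Fin p) ℝ) (y : Fin n → ℝ)
    (b : EuclideanSpace ℝ (Fin p)) : EuclideanSpace ℝ (Fin p) :=
  if h : ∃ β ∈ interpolators X y, IsMinOn (fun β' => ‖β' - b‖) (interpolators X y) β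
  then h.choose else 0

/-- The minimum-`ℓ₂`-norm interpolator `argmin {‖β‖ : X β = y}`. -/
def mni {n p : ℕ} (X : Matrix (Fin n) (Fin p) ℝ) (y : Fin n → ℝ) : EuclideanSpace ℝ (Fin p) :=
  nearestInterpolator X y 0

/-- The Transfer MNI: the interpolator of the target data `(X₀, y₀)` that is closest to the MNI
pre-trained on the source data `(X₁, y₁)`. -/
def transferMNI {n₀ n₁ p : ℕ} (X₀ : Matrix (Fin n₀) (Fin p) ℝ) (y₀ : Fin n₀ → ℝ)
    (X₁ : Matrix (Fin n₁) (Fin p) ℝ) (y₁ : Fin n₁ → ℝ) : EuclideanSpace ℝ (Fin p) :=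
  nearestInterpolator X₀ y₀ (mni X₁ y₁)

/-! ### Data: designs, noise, responses -/

/-- The σ-algebra generated by the entries of a random matrix. -/
abbrev matrixSigma {Ω : Type*} {n p : ℕ} (X : Ω → Matrix (Fin n) (Fin p) ℝ) : MeasurableSpace Ω :=
  MeasurableSpace.comap (fun ω (i : Fin n) (j : Fin p) => X ω i j) inferInstance

/-- The σ-algebra generated by a random vector. -/
abbrev vectorSigma {Ω : Type*} {n : ℕ} (e : Ω → Fin n → ℝ) : MeasurableSpace Ω :=
  MeasurableSpace.comap e inferInstance

/-- The σ-algebra generated by a family of random designs, `σ(𝒳)`. -/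
abbrev designSigma {Ω ι : Type*} {n : ι → ℕ} {p : ℕ}
    (X : (k : ι) → Ω → Matrix (Fin (n k)) (Fin p) ℝ) : MeasurableSpace Ω :=
  ⨆ k, matrixSigma (X k)

/-- A random matrix with i.i.d. standard Gaussian entries. -/
structure IsStdGaussianMatrix {Ω : Type*} [MeasurableSpace Ω] (μ : Measure Ω) {n p : ℕ}
    (X : Ω → Matrix (Fin n) (Fin p) ℝ) : Prop where
  indep : iIndepFun (fun (a : Fin n × Fin p) ω => X ω a.1 a.2) μ
  law : ∀ i j, HasLaw (fun ω => X ω i j) (gaussianReal 0 1) μ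

/-- A noise vector with i.i.d. components of mean zero and finite variance `s²`. -/
structure IsNoise {Ω : Type*} [MeasurableSpace Ω] (μ : Measure Ω) {n : ℕ}
    (e : Ω → Fin n → ℝ) (s : ℝ) : Prop where
  indep : iIndepFun (fun (i : Fin n) ω => e ω i) μ
  ident : ∀ i j, IdentDistrib (fun ω => e ω i) (fun ω => e ω j) μ μ
  memLp : ∀ i, MemLp (fun ω => e ω i) 2 μ
  mean : ∀ i, ∫ ω, e ω i ∂μ = 0
  var : ∀ i, variance (fun ω => e ω i) μ = s ^ 2

/-- The response of the linear model `y = X β + ε`. -/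
def response {Ω : Type*} {n p : ℕ} (X : Ω → Matrix (Fin n) (Fin p) ℝ)
    (β : EuclideanSpace ℝ (Fin p)) (e : Ω → Fin n → ℝ) : Ω → Fin n → ℝ :=
  fun ω => X ω *ᵥ β.ofLp + e ω

/-! ### Conditional bias and variance of an estimator -/

section BiasVariance

variable {Ω : Type*} {mΩ : MeasurableSpace Ω} {p : ℕ}

/-- The conditional mean `𝔼[b | m]` of a random vector `b`, coordinate by coordinate. -/
def condMean (μ : Measure Ω) (m : MeasurableSpace Ω) (b : Ω → EuclideanSpace ℝ (Fin p)) :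
    Ω → Fin p → ℝ :=
  fun ω i => (μ[fun ω' => b ω' i | m]) ω

/-- The conditional covariance matrix `Cov(b | m)` of a random vector `b`. -/
def condCov (μ : Measure Ω) (m : MeasurableSpace Ω) (b : Ω → EuclideanSpace ℝ (Fin p)) :
    Ω → Matrix (Fin p) (Fin p) ℝ :=
  fun ω => Matrix.of fun i j =>
    (μ[fun ω' => (b ω' i - condMean μ m b ω' i) * (b ω' j - condMean μ m b ω' j) | m]) ω

/-- The (squared) conditional bias `(𝔼[b | m] - β)ᵀ Σ (𝔼[b | m] - β)` of an estimator `b` of `β`,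
measured on a target distribution with covariance `S`. -/
def bias (μ : Measure Ω) (m : MeasurableSpace Ω) (S : Matrix (Fin p) (Fin p) ℝ)
    (β : EuclideanSpace ℝ (Fin p)) (b : Ω → EuclideanSpace ℝ (Fin p)) : Ω → ℝ :=
  fun ω => (condMean μ m b ω - β.ofLp) ⬝ᵥ (S *ᵥ (condMean μ m b ω - β.ofLp))

/-- The conditional variance `Tr(Σ Cov(b | m))` of an estimator `b`, measured on a target
distribution with covariance `S`. -/
def condVariance (μ : Measure Ω) (m : MeasurableSpace Ω) (S : Matrix (Fin p) (Fin p) ℝ)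
    (b : Ω → EuclideanSpace ℝ (Fin p)) : Ω → ℝ :=
  fun ω => (S * condCov μ m b ω).trace

end BiasVariance

/-! ### Closed forms in terms of the designs -/

/-- `H = Xᵀ (X Xᵀ)† X`, the orthogonal projection onto the row space of `X`. -/
def rowProj {n p : ℕ} (X : Matrix (Fin n) (Fin p) ℝ) : Matrix (Fin p) (Fin p) ℝ :=
  Xᵀ * pinv (X * Xᵀ) * X

/-- The sample covariance `(1/n) Xᵀ X`. -/
def sampleCov {n p : ℕ} (X : Matrix (Fin n) (Fin p) ℝ) : Matrix (Fin p) (Fin p) ℝ :=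
  (1 / (n : ℝ)) • (Xᵀ * X)

/-- `Π = (I - H) Σ (I - H)`. -/
def nullCov {n p : ℕ} (S : Matrix (Fin p) (Fin p) ℝ) (X : Matrix (Fin n) (Fin p) ℝ) :
    Matrix (Fin p) (Fin p) ℝ :=
  (1 - rowProj X) * S * (1 - rowProj X)

/-- `βᵀ Π β`. -/
def biasMNI {n p : ℕ} (S : Matrix (Fin p) (Fin p) ℝ) (X₀ : Matrix (Fin n) (Fin p) ℝ)
    (β : EuclideanSpace ℝ (Fin p)) : ℝ :=
  β.ofLp ⬝ᵥ (nullCov S X₀ *ᵥ β.ofLp)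

/-- `(s²/n) Tr(Σ̂† Σ)`. -/
def varMNI {n p : ℕ} (S : Matrix (Fin p) (Fin p) ℝ) (X₀ : Matrix (Fin n) (Fin p) ℝ)
    (s : ℝ) : ℝ :=
  s ^ 2 / n * (pinv (sampleCov X₀) * S).trace

/-- `βᵀ (I - H₁) Π₀ (I - H₁) β + δᵀ H₁ Π₀ H₁ δ - 2 δᵀ H₁ Π₀ (I - H₁) β`. -/
def biasTM {n₀ n₁ p : ℕ} (S : Matrix (Fin p) (Fin p) ℝ) (X₀ : Matrix (Fin n₀) (Fin p) ℝ)
    (X₁ : Matrix (Fin n₁) (Fin p) ℝ) (β δ : EuclideanSpace ℝ (Fin p)) : ℝ :=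
  β.ofLp ⬝ᵥ (((1 - rowProj X₁) * nullCov S X₀ * (1 - rowProj X₁)) *ᵥ β.ofLp)
    + δ.ofLp ⬝ᵥ ((rowProj X₁ * nullCov S X₀ * rowProj X₁) *ᵥ δ.ofLp)
    - 2 * (δ.ofLp ⬝ᵥ ((rowProj X₁ * nullCov S X₀ * (1 - rowProj X₁)) *ᵥ β.ofLp))

/-- The variance inflation `(s²/n₁) Tr(Σ̂₁† Π₀)`. -/
def varInflation {n₀ n₁ p : ℕ} (S : Matrix (Fin p) (Fin p) ℝ) (X₀ : Matrix (Fin n₀) (Fin p) ℝ)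
    (X₁ : Matrix (Fin n₁) (Fin p) ℝ) (s : ℝ) : ℝ :=
  s ^ 2 / n₁ * (pinv (sampleCov X₁) * nullCov S X₀).trace

end TransferMNI

end

/-!
Almost surely the Gram matrices `X Xᵀ` of the two Gaussian designs are invertible. Then the
interpolators are explicit: with `X† = Xᵀ (X Xᵀ)⁻¹` (`rightInv`) and `H = X† X`, the MNI is `X† y`
and the transfer MNI is `b + X₀† (y₀ - X₀ b)`, where `b` is the MNI of the source. Both are of the
form `a + B ε` with `a`, `B` functions of the designs and `ε` the noise, which is independent of
the designs (`AffineInNoise`). Since `B` is square integrable, the conditional mean is `a` and the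
trace of the conditional covariance is the sum of `σ² B²` over the entries. This gives the closed
forms; in particular the bias of the transfer MNI is `wᵀ (I - H₀) w` with
`w = H₁ δ - (I - H₁) β` (`sourceError`).

For the expectations two facts about a Gaussian `n × p` matrix `X` suffice.

* `𝔼 H = (n / p) I` (`integral_proj_apply`), because the law of `X` is invariant under signed
  permutations of the columns and `tr H = n`.
* `𝔼 tr (X Xᵀ)⁻¹ = n / (p - n - 1)` (`integral_trace_gram_inv`). A diagonal entry of the inverse
  Gram matrix is the reciprocal of the squared distance of a row from the span of the other rows.
  Given the other rows this squared distance is a chi-square variable with `d = p - n + 1` degrees of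
  freedom, whose Laplace transform is `u ^ (-d / 2)` at `(u - 1) / 2`; integrating over `u > 1`
  shows that its inverse has mean `1 / (d - 2)`. The finiteness of this mean also shows, by
  induction on the number of rows, that `X` has full row rank almost surely.

Finally `I - H₀` is independent of the source design and has mean `((p - n₀) / p) I`, so that
`𝔼 tr ((I - H₀) C) = ((p - n₀) / p) 𝔼 tr C` for every `C` that is a function of the source design
(`integral_trace_mul_of_indep`). The bias of the transfer MNI is the case `C = w wᵀ`, the variance
inflation the case `C = X₁† X₁†ᵀ`.
-/

noncomputable section

namespace TransferMNI

/-! ### Designs of full row rank -/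

section FullRank

variable {n p : ℕ}

theorem IsMoorePenrose.pinv_eq {m n : ℕ} {A : Matrix (Fin m) (Fin n) ℝ}
    {P : Matrix (Fin n) (Fin m) ℝ} (hP : IsMoorePenrose A P) : pinv A = P :=
  (exists_isMoorePenrose A).choose_spec.unique hP

theorem pinv_eq_inv {A : Matrix (Fin n) (Fin n) ℝ} (hA : IsUnit A.det) : pinv A = A⁻¹ :=
  IsMoorePenrose.pinv_eq
    ⟨by rw [Matrix.mul_nonsing_inv _ hA, one_mul], by rw [Matrix.nonsing_inv_mul _ hA, one_mul],
     by rw [Matrix.mul_nonsing_inv _ hA, Matrix.transpose_one],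
     by rw [Matrix.nonsing_inv_mul _ hA, Matrix.transpose_one]⟩

/-- The right inverse `Xᵀ (X Xᵀ)⁻¹` of a matrix of full row rank (its Moore–Penrose inverse). -/
def rightInv (X : Matrix (Fin n) (Fin p) ℝ) : Matrix (Fin p) (Fin n) ℝ := Xᵀ * (X * Xᵀ)⁻¹

theorem gram_inv_transpose (X : Matrix (Fin n) (Fin p) ℝ) : ((X * Xᵀ)⁻¹)ᵀ = (X * Xᵀ)⁻¹ := by
  rw [Matrix.transpose_nonsing_inv, Matrix.transpose_mul, Matrix.transpose_transpose]

theorem mul_rightInv {X : Matrix (Fin n) (Fin p) ℝ} (hX : IsUnit (X * Xᵀ).det) :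
    X * rightInv X = 1 := by
  rw [rightInv, ← Matrix.mul_assoc, Matrix.mul_nonsing_inv _ hX]

theorem rowProj_eq_rightInv_mul {X : Matrix (Fin n) (Fin p) ℝ} (hX : IsUnit (X * Xᵀ).det) :
    rowProj X = rightInv X * X := by
  rw [rowProj, rightInv, pinv_eq_inv hX]

theorem rightInv_mul_transpose (X : Matrix (Fin n) (Fin p) ℝ) :
    (rightInv X * X)ᵀ = rightInv X * X := by
  rw [rightInv, Matrix.transpose_mul, Matrix.transpose_mul, gram_inv_transpose,
    Matrix.transpose_transpose, Matrix.mul_assoc]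

theorem rightInv_mul_idem {X : Matrix (Fin n) (Fin p) ℝ} (hX : IsUnit (X * Xᵀ).det) :
    (rightInv X * X) * (rightInv X * X) = rightInv X * X := by
  rw [Matrix.mul_assoc, ← Matrix.mul_assoc X, mul_rightInv hX, Matrix.one_mul]

theorem trace_rightInv_mul {X : Matrix (Fin n) (Fin p) ℝ} (hX : IsUnit (X * Xᵀ).det) :
    (rightInv X * X).trace = n := by
  rw [Matrix.trace_mul_comm, mul_rightInv hX]; simp

theorem rightInv_transpose_mul_self {X : Matrix (Fin n) (Fin p) ℝ} (hX : IsUnit (X * Xᵀ).det) :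
    (rightInv X)ᵀ * rightInv X = (X * Xᵀ)⁻¹ := by
  conv_lhs => enter [1]; rw [rightInv, Matrix.transpose_mul, Matrix.transpose_transpose]
  rw [gram_inv_transpose, Matrix.mul_assoc, mul_rightInv hX, Matrix.mul_one]

theorem one_sub_rightInv_mul_idem {X : Matrix (Fin n) (Fin p) ℝ} (hX : IsUnit (X * Xᵀ).det) :
    (1 - rightInv X * X) * (1 - rightInv X * X) = 1 - rightInv X * X := by
  simp [Matrix.sub_mul, Matrix.mul_sub, rightInv_mul_idem hX]

theorem nullCov_one {X : Matrix (Fin n) (Fin p) ℝ} (hX : IsUnit (X * Xᵀ).det) :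
    nullCov 1 X = 1 - rightInv X * X := by
  rw [nullCov, rowProj_eq_rightInv_mul hX, Matrix.mul_one, one_sub_rightInv_mul_idem hX]

/-- `(c XᵀX)† = c⁻¹ Xᵀ (X Xᵀ)⁻² X`, written through the right inverse of `X`. -/
theorem pinv_smul_gram {X : Matrix (Fin n) (Fin p) ℝ} (hX : IsUnit (X * Xᵀ).det) {c : ℝ}
    (hc : c ≠ 0) : pinv (c • (Xᵀ * X)) = c⁻¹ • (rightInv X * (rightInv X)ᵀ) := by
  have h1 : X * rightInv X = 1 := mul_rightInv hX
  have h2 : (rightInv X)ᵀ * Xᵀ = 1 := by rw [← Matrix.transpose_mul, h1, Matrix.transpose_one]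
  have h3 : Xᵀ * (rightInv X)ᵀ = rightInv X * X := by
    rw [← Matrix.transpose_mul, rightInv_mul_transpose]
  have e1 : Xᵀ * X * (rightInv X * (rightInv X)ᵀ) = rightInv X * X := by
    rw [Matrix.mul_assoc, ← Matrix.mul_assoc X, h1, Matrix.one_mul, h3]
  have e2 : rightInv X * (rightInv X)ᵀ * (Xᵀ * X) = rightInv X * X := by
    rw [Matrix.mul_assoc, ← Matrix.mul_assoc _ Xᵀ, h2, Matrix.one_mul]
  apply IsMoorePenrose.pinv_eq
  refine ⟨?_, ?_, ?_, ?_⟩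
  · have : (c • (Xᵀ * X)) * (c⁻¹ • (rightInv X * (rightInv X)ᵀ)) = rightInv X * X := by
      rw [Matrix.smul_mul, Matrix.mul_smul, smul_smul, mul_inv_cancel₀ hc, one_smul, e1]
    rw [this,
      ← h3, Matrix.mul_smul, Matrix.mul_assoc, ← Matrix.mul_assoc _ Xᵀ, h2, Matrix.one_mul]
  · have : (c⁻¹ • (rightInv X * (rightInv X)ᵀ)) * (c • (Xᵀ * X)) = rightInv X * X := by
      rw [Matrix.smul_mul, Matrix.mul_smul, smul_smul, inv_mul_cancel₀ hc, one_smul, e2]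
    rw [this, Matrix.mul_smul, Matrix.mul_assoc, ← Matrix.mul_assoc X, h1, Matrix.one_mul]
  · rw [Matrix.smul_mul, Matrix.mul_smul, smul_smul, mul_inv_cancel₀ hc, one_smul, e1,
      rightInv_mul_transpose]
  · rw [Matrix.smul_mul, Matrix.mul_smul, smul_smul, inv_mul_cancel₀ hc, one_smul, e2,
      rightInv_mul_transpose]

/-- The scaled trace of `Σ̂† S` no longer involves the sample size. For `n = 0` the left side has
the factor `s² / 0 = 0`, and on the right the inner dimension of the product is `0`. -/
theorem smul_trace_pinv_sampleCov {X : Matrix (Fin n) (Fin p) ℝ} (hX : IsUnit (X * Xᵀ).det)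
    (s : ℝ) (S : Matrix (Fin p) (Fin p) ℝ) :
    s ^ 2 / n * (pinv (sampleCov X) * S).trace
      = s ^ 2 * (rightInv X * (rightInv X)ᵀ * S).trace := by
  rcases Nat.eq_zero_or_pos n with rfl | hn
  · simp
  · have hn' : (n : ℝ) ≠ 0 := by positivity
    rw [sampleCov, pinv_smul_gram hX (by positivity), Matrix.smul_mul, Matrix.trace_smul]
    simp; field_simp

/-- For a design of full row rank the interpolator nearest to `b` is `b + X†(y - X b)`: its
difference from `b` lies in the row space, hence is orthogonal to the differences between
interpolators. -/
theorem nearestInterpolator_eq {X : Matrix (Fin n) (Fin p) ℝ} (hX : IsUnit (X * Xᵀ).det)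
    (y : Fin n → ℝ) (b : EuclideanSpace ℝ (Fin p)) :
    (nearestInterpolator X y b).ofLp = b.ofLp + rightInv X *ᵥ (y - X *ᵥ b.ofLp) := by
  set a : EuclideanSpace ℝ (Fin p) :=
    WithLp.toLp 2 (b.ofLp + rightInv X *ᵥ (y - X *ᵥ b.ofLp)) with ha
  have hmem : a ∈ interpolators X y := by
    simp [interpolators, ha, Matrix.mulVec_add, mul_rightInv hX]
  have hpyth : ∀ c ∈ interpolators X y, ‖c - b‖ ^ 2 = ‖c - a‖ ^ 2 + ‖a - b‖ ^ 2 := by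
    intro c hc
    have horth : inner ℝ (c - a) (a - b) = 0 := by
      have hker : X *ᵥ (c.ofLp - a.ofLp) = 0 := by
        rw [Matrix.mulVec_sub, show X *ᵥ c.ofLp = y from hc, show X *ᵥ a.ofLp = y from hmem,
          sub_self]
      have hab : (a - b).ofLp = Xᵀ *ᵥ ((X * Xᵀ)⁻¹ *ᵥ (y - X *ᵥ b.ofLp)) := by
        simp [ha, rightInv]
      rw [EuclideanSpace.inner_eq_star_dotProduct, hab]
      simp only [star_trivial]
      rw [dotProduct_comm, Matrix.dotProduct_mulVec, Matrix.vecMul_transpose]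
      simp [hker]
    have := norm_add_sq_real (c - a) (a - b)
    rw [horth, sub_add_sub_cancel] at this
    linarith
  have hmin : IsMinOn (fun c => ‖c - b‖) (interpolators X y) a := by
    intro c hc
    have := hpyth c hc
    exact abs_le_of_sq_le_sq' (by nlinarith [sq_nonneg ‖c - a‖]) (norm_nonneg _) |>.2
  have hex : ∃ c ∈ interpolators X y, IsMinOn (fun c' => ‖c' - b‖) (interpolators X y) c :=
    ⟨a, hmem, hmin⟩
  have heq : nearestInterpolator X y b = a := by
    rw [nearestInterpolator, dif_pos hex]
    obtain ⟨h1, h2⟩ := hex.choose_spec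
    have h3 := hpyth _ h1
    have h4 : ‖hex.choose - b‖ ≤ ‖a - b‖ := h2 hmem
    have h5 : ‖hex.choose - a‖ ^ 2 ≤ 0 := by nlinarith [norm_nonneg (hex.choose - b)]
    have h6 : ‖hex.choose - a‖ = 0 := by nlinarith [norm_nonneg (hex.choose - a)]
    exact sub_eq_zero.1 (norm_eq_zero.1 h6)
  rw [heq]

theorem mni_eq {X : Matrix (Fin n) (Fin p) ℝ} (hX : IsUnit (X * Xᵀ).det) (y : Fin n → ℝ) :
    (mni X y).ofLp = rightInv X *ᵥ y := by
  rw [mni, nearestInterpolator_eq hX]; simp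

/-- The entries of a symmetric idempotent matrix are bounded by `1`. -/
theorem abs_apply_le_one_of_symm_idem {ι : Type*} [Fintype ι] {M : Matrix ι ι ℝ} (hs : Mᵀ = M)
    (hi : M * M = M) (i j : ι) : |M i j| ≤ 1 := by
  have hdiag : ∑ k, M i k ^ 2 = M i i := by
    conv_rhs => rw [← hi, Matrix.mul_apply]
    refine Finset.sum_congr rfl fun k _ => ?_
    rw [sq, ← Matrix.transpose_apply M i k, hs]
  have h1 : ∀ k, M i k ^ 2 ≤ M i i := fun k => by
    rw [← hdiag]
    exact Finset.single_le_sum (f := fun k => M i k ^ 2) (fun _ _ => sq_nonneg _)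
      (Finset.mem_univ k)
  have h2 : M i i ≤ 1 := by nlinarith [h1 i, sq_nonneg (M i i)]
  exact abs_le_one_iff_mul_self_le_one.2 (by nlinarith [h1 j])

theorem abs_rightInv_mul_le {X : Matrix (Fin n) (Fin p) ℝ} (hX : IsUnit (X * Xᵀ).det)
    (i j : Fin p) : |(rightInv X * X) i j| ≤ 1 :=
  abs_apply_le_one_of_symm_idem (rightInv_mul_transpose X) (rightInv_mul_idem hX) i j

end FullRank

/-! ### Adding a row -/

section InsertRow

variable {n p : ℕ}

/-- The matrix obtained from `Y` by inserting `x` as the row `i`. -/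
def insertRow (i : Fin (n + 1)) (x : Fin p → ℝ) (Y : Matrix (Fin n) (Fin p) ℝ) :
    Matrix (Fin (n + 1)) (Fin p) ℝ :=
  Matrix.of (Fin.insertNth (α := fun _ => Fin p → ℝ) i x fun k => Y k)

@[simp]
theorem insertRow_same (i : Fin (n + 1)) (x : Fin p → ℝ) (Y : Matrix (Fin n) (Fin p) ℝ) :
    insertRow i x Y i = x :=
  Fin.insertNth_apply_same (α := fun _ => Fin p → ℝ) i x _

@[simp]
theorem insertRow_succAbove (i : Fin (n + 1)) (x : Fin p → ℝ) (Y : Matrix (Fin n) (Fin p) ℝ)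
    (k : Fin n) : insertRow i x Y (i.succAbove k) = Y k :=
  Fin.insertNth_apply_succAbove (α := fun _ => Fin p → ℝ) i x _ k

/-- The squared distance from `x` to the row space of `Y` (when `Y` has full row rank). -/
def residual (Y : Matrix (Fin n) (Fin p) ℝ) (x : Fin p → ℝ) : ℝ :=
  x ⬝ᵥ ((1 - rightInv Y * Y) *ᵥ x)

/-- Solving for the column `i` of the inverse Gram matrix: the vector `v` with `v i = 1` and the
negative regression coefficients of `x` on the other rows elsewhere satisfies
`X Xᵀ v = residual • eᵢ`. -/
theorem exists_gram_mulVec_eq_single {Y : Matrix (Fin n) (Fin p) ℝ} (hY : IsUnit (Y * Yᵀ).det)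
    (x : Fin p → ℝ) (i : Fin (n + 1)) :
    ∃ v : Fin (n + 1) → ℝ, v i = 1 ∧
      insertRow i x Y *ᵥ ((insertRow i x Y)ᵀ *ᵥ v)
        = Pi.single i (residual Y x) := by
  have hT : ∀ v : Fin (n + 1) → ℝ, (insertRow i x Y)ᵀ *ᵥ v
      = v i • x + Yᵀ *ᵥ (fun k => v (i.succAbove k)) := by
    intro v; ext j
    simp [Matrix.mulVec, dotProduct, Fin.sum_univ_succAbove _ i, mul_comm]
  refine ⟨i.insertNth 1 (-((Y * Yᵀ)⁻¹ *ᵥ (Y *ᵥ x))), by simp, ?_⟩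
  have hu : (insertRow i x Y)ᵀ *ᵥ (i.insertNth 1 (-((Y * Yᵀ)⁻¹ *ᵥ (Y *ᵥ x))))
      = (1 - rightInv Y * Y) *ᵥ x := by
    rw [hT]
    simp only [Fin.insertNth_apply_same, one_smul, Fin.insertNth_apply_succAbove]
    rw [Matrix.sub_mulVec, Matrix.one_mulVec, show
      (fun k => (-((Y * Yᵀ)⁻¹ *ᵥ (Y *ᵥ x))) k) = -((Y * Yᵀ)⁻¹ *ᵥ (Y *ᵥ x)) from rfl,
      Matrix.mulVec_neg, rightInv, ← sub_eq_add_neg]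
    simp [Matrix.mul_assoc]
  rw [hu]
  ext k
  refine Fin.succAboveCases i ?_ (fun k => ?_) k
  · simp [Matrix.mulVec, residual, dotProduct]
  · have hz : Y *ᵥ ((1 - rightInv Y * Y) *ᵥ x) = 0 := by
      rw [Matrix.mulVec_mulVec, Matrix.mul_sub, ← Matrix.mul_assoc, mul_rightInv hY]
      simp
    have := congrFun hz k
    simpa [Matrix.mulVec, dotProduct] using this

/-- The Gram matrix stays invertible when a row off the row space is inserted: a vector `w` with
`Xᵀ w = 0` is orthogonal to `X Xᵀ v = residual • eᵢ`, so `w i = 0`, and the other rows are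
independent. -/
theorem isUnit_det_gram_insertNth {Y : Matrix (Fin n) (Fin p) ℝ} (hY : IsUnit (Y * Yᵀ).det)
    {x : Fin p → ℝ} (hx : residual Y x ≠ 0) (i : Fin (n + 1)) :
    IsUnit (insertRow i x Y * (insertRow i x Y)ᵀ).det := by
  set X := insertRow i x Y with hXdef
  rw [isUnit_iff_ne_zero]
  intro h0
  obtain ⟨w, hw0, hw⟩ := Matrix.exists_mulVec_eq_zero_iff.2 h0
  have hXw : Xᵀ *ᵥ w = 0 := by
    have h : (Xᵀ *ᵥ w) ⬝ᵥ (Xᵀ *ᵥ w) = 0 := by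
      rw [Matrix.dotProduct_mulVec, Matrix.vecMul_transpose, Matrix.mulVec_mulVec, hw]
      simp
    exact dotProduct_self_eq_zero.1 h
  obtain ⟨v, -, hv⟩ := exists_gram_mulVec_eq_single hY x i
  have hwi : w i = 0 := by
    have h : w ⬝ᵥ (X *ᵥ (Xᵀ *ᵥ v)) = 0 := by
      rw [Matrix.dotProduct_mulVec, ← Matrix.mulVec_transpose, hXw]; simp
    rw [hv] at h
    simpa [hx] using h
  have hwY : Yᵀ *ᵥ (fun k => w (i.succAbove k)) = 0 := by
    ext j
    have := congrFun hXw j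
    simpa [hXdef, Matrix.mulVec, dotProduct, Fin.sum_univ_succAbove _ i, hwi] using this
  have hw' : (fun k => w (i.succAbove k)) = 0 := by
    have h : (Y * Yᵀ)⁻¹ *ᵥ ((Y * Yᵀ) *ᵥ (fun k => w (i.succAbove k))) = 0 := by
      rw [← Matrix.mulVec_mulVec _ Y, hwY]; simp
    rwa [Matrix.mulVec_mulVec, Matrix.nonsing_inv_mul _ hY, Matrix.one_mulVec] at h
  apply hw0
  ext k
  refine Fin.succAboveCases i hwi (fun k => ?_) k
  exact congrFun hw' k

/-- A diagonal entry of the inverse Gram matrix is the reciprocal of the squared distance of the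
corresponding row from the span of the others. -/
theorem gram_inv_insertNth_apply {Y : Matrix (Fin n) (Fin p) ℝ} (hY : IsUnit (Y * Yᵀ).det)
    {x : Fin p → ℝ} (hx : residual Y x ≠ 0) (i : Fin (n + 1)) :
    (insertRow i x Y * (insertRow i x Y)ᵀ)⁻¹ i i
      = (residual Y x)⁻¹ := by
  have hU := isUnit_det_gram_insertNth hY hx i
  obtain ⟨v, hvi, hv⟩ := exists_gram_mulVec_eq_single hY x i
  set X := insertRow i x Y
  have h : v = (X * Xᵀ)⁻¹ *ᵥ Pi.single i (residual Y x) := by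
    rw [← hv, Matrix.mulVec_mulVec v X, Matrix.mulVec_mulVec, Matrix.nonsing_inv_mul _ hU,
      Matrix.one_mulVec]
  have h2 := congrFun h i
  rw [hvi, Matrix.mulVec_single] at h2
  simp at h2
  exact eq_inv_of_mul_eq_one_left (by linarith)

end InsertRow

/-! ### Standard Gaussian vectors -/

/-- The law of a vector with `p` independent standard Gaussian coordinates. -/
abbrev gaussVec (p : ℕ) : Measure (Fin p → ℝ) := Measure.pi fun _ => gaussianReal 0 1

section GaussVec

variable {p : ℕ}

/-- Rotation invariance of the standard Gaussian law. -/
theorem measurePreserving_gaussVec_of_orthogonal {U : Matrix (Fin p) (Fin p) ℝ}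
    (hU : Uᵀ * U = 1) : MeasurePreserving (fun x => U *ᵥ x) (gaussVec p) (gaussVec p) := by
  let f : EuclideanSpace ℝ (Fin p) →ₗᵢ[ℝ] EuclideanSpace ℝ (Fin p) :=
    { toLinearMap := Matrix.toEuclideanLin U
      norm_map' := by
        intro x
        have h : ‖Matrix.toEuclideanLin U x‖ ^ 2 = ‖x‖ ^ 2 := by
          rw [← real_inner_self_eq_norm_sq, ← real_inner_self_eq_norm_sq,
            EuclideanSpace.inner_eq_star_dotProduct, EuclideanSpace.inner_eq_star_dotProduct]
          simp only [star_trivial, Matrix.ofLp_toLpLin, Matrix.toLin'_apply]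
          rw [Matrix.dotProduct_mulVec, ← Matrix.mulVec_transpose, Matrix.mulVec_mulVec, hU,
            Matrix.one_mulVec]
        exact (sq_eq_sq₀ (norm_nonneg _) (norm_nonneg _)).1 h }
  let e : EuclideanSpace ℝ (Fin p) ≃ₗᵢ[ℝ] EuclideanSpace ℝ (Fin p) :=
    f.toLinearIsometryEquiv rfl
  have h1 : MeasurePreserving (WithLp.toLp 2 : (Fin p → ℝ) → EuclideanSpace ℝ (Fin p))
      (gaussVec p) (stdGaussian (EuclideanSpace ℝ (Fin p))) :=
    ⟨by fun_prop, map_pi_eq_stdGaussian⟩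
  have h2 : MeasurePreserving e (stdGaussian (EuclideanSpace ℝ (Fin p)))
      (stdGaussian (EuclideanSpace ℝ (Fin p))) :=
    ⟨e.continuous.measurable, stdGaussian_map e⟩
  have h3 : MeasurePreserving (WithLp.ofLp : EuclideanSpace ℝ (Fin p) → (Fin p → ℝ))
      (stdGaussian (EuclideanSpace ℝ (Fin p))) (gaussVec p) :=
    h1.symm (MeasurableEquiv.toLp 2 (Fin p → ℝ))
  exact h3.comp (h2.comp h1)

/-- The Laplace transform of the square of a standard Gaussian variable, at `(u - 1) / 2`. This
parametrization makes the value a power of `u`, as needed for `lintegral_exp_eq_inv`. -/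
theorem integral_exp_sq_gaussianReal {u : ℝ} (hu : 1 ≤ u) :
    ∫ z, Real.exp (-((u - 1) / 2) * z ^ 2) ∂gaussianReal 0 1 = u ^ (-(1 / 2) : ℝ) := by
  rw [integral_gaussianReal_eq_integral_smul one_ne_zero]
  have h : ∀ z : ℝ, gaussianPDFReal 0 1 z • Real.exp (-((u - 1) / 2) * z ^ 2)
      = (√(2 * Real.pi))⁻¹ * Real.exp (-(u / 2) * z ^ 2) := by
    intro z
    rw [gaussianPDFReal, smul_eq_mul, mul_assoc, ← Real.exp_add]
    simp only [NNReal.coe_one, mul_one, sub_zero]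
    congr 2; ring
  simp_rw [h]
  rw [integral_const_mul, integral_gaussian, ← Real.sqrt_inv, ← Real.sqrt_mul (by positivity),
    Real.rpow_neg (by positivity), ← Real.sqrt_eq_rpow, ← Real.sqrt_inv]
  congr 1
  field_simp

/-- The Laplace transform of a chi-square variable: for an orthogonal projection `M`, the form
`xᵀ M x` of a standard Gaussian `x` is a sum of `tr M` independent squares. -/
theorem integral_exp_quadraticForm {M : Matrix (Fin p) (Fin p) ℝ} (hs : Mᵀ = M)
    (hi : M * M = M) {u : ℝ} (hu : 1 ≤ u) :
    ∫ x, Real.exp (-((u - 1) / 2) * (x ⬝ᵥ (M *ᵥ x))) ∂gaussVec p = u ^ (-(M.trace / 2)) := by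
  have hM : M.IsHermitian := by
    rwa [Matrix.IsHermitian, Matrix.conjTranspose_eq_transpose_of_trivial]
  set U : Matrix (Fin p) (Fin p) ℝ := hM.eigenvectorUnitary.1 with hU
  set lam := hM.eigenvalues with hlam
  have hUU : U * Uᵀ = 1 := by
    have := Unitary.coe_mul_star_self hM.eigenvectorUnitary
    simpa [Matrix.star_eq_conjTranspose, Matrix.conjTranspose_eq_transpose_of_trivial] using this
  have hUU' : Uᵀ * U = 1 := mul_eq_one_comm.1 hUU
  have hMs : M = U * Matrix.diagonal lam * Uᵀ := by
    have h := hM.spectral_theorem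
    rw [Unitary.conjStarAlgAut_apply] at h
    simpa [Matrix.star_eq_conjTranspose, Matrix.conjTranspose_eq_transpose_of_trivial,
      Function.comp_def] using h
  have hlam01 : ∀ i, lam i = 0 ∨ lam i = 1 := by
    intro i
    have h : Matrix.diagonal lam * Matrix.diagonal lam = Matrix.diagonal lam := by
      have hD : Matrix.diagonal lam = Uᵀ * M * U := by
        rw [hMs]
        calc Matrix.diagonal lam = (Uᵀ * U) * Matrix.diagonal lam * (Uᵀ * U) := by
              rw [hUU']; simp
          _ = _ := by simp only [Matrix.mul_assoc]
      rw [hD]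
      calc Uᵀ * M * U * (Uᵀ * M * U) = Uᵀ * M * (U * Uᵀ) * M * U := by
            simp only [Matrix.mul_assoc]
        _ = Uᵀ * M * U := by rw [hUU, Matrix.mul_one, Matrix.mul_assoc Uᵀ M M, hi]
    rw [Matrix.diagonal_mul_diagonal] at h
    have := congrFun (Matrix.diagonal_injective h) i
    have h2 : lam i * (lam i - 1) = 0 := by linarith
    rcases mul_eq_zero.1 h2 with h | h
    · exact Or.inl h
    · exact Or.inr (by linarith)
  have htr : M.trace = ∑ i, lam i := by
    rw [hMs, Matrix.trace_mul_comm, ← Matrix.mul_assoc, hUU', Matrix.one_mul,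
      Matrix.trace_diagonal]
  have hq : ∀ x : Fin p → ℝ, x ⬝ᵥ (M *ᵥ x) = ∑ i, lam i * (Uᵀ *ᵥ x) i ^ 2 := by
    intro x
    rw [hMs, ← Matrix.mulVec_mulVec, ← Matrix.mulVec_mulVec, Matrix.dotProduct_mulVec,
      ← Matrix.mulVec_transpose, dotProduct]
    refine Finset.sum_congr rfl fun i _ => ?_
    rw [Matrix.mulVec_diagonal]; ring
  have hmp : MeasurePreserving (fun x => Uᵀ *ᵥ x) (gaussVec p) (gaussVec p) :=
    measurePreserving_gaussVec_of_orthogonal (by rw [Matrix.transpose_transpose, hUU])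
  calc ∫ x, Real.exp (-((u - 1) / 2) * (x ⬝ᵥ (M *ᵥ x))) ∂gaussVec p
      = ∫ x, (fun z : Fin p → ℝ => Real.exp (-((u - 1) / 2) * ∑ i, lam i * z i ^ 2)) (Uᵀ *ᵥ x)
          ∂gaussVec p := by simp only [hq]
    _ = ∫ z, Real.exp (-((u - 1) / 2) * ∑ i, lam i * z i ^ 2) ∂gaussVec p := by
        conv_rhs => rw [← hmp.map_eq]
        rw [integral_map hmp.measurable.aemeasurable]
        exact (by fun_prop : Continuous fun z : Fin p → ℝ =>
          Real.exp (-((u - 1) / 2) * ∑ i, lam i * z i ^ 2)).aestronglyMeasurable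
    _ = ∫ z, ∏ i, Real.exp (-((u - 1) / 2) * (lam i * z i ^ 2)) ∂gaussVec p := by
        simp_rw [Finset.mul_sum, Real.exp_sum]
    _ = ∏ i, ∫ z, Real.exp (-((u - 1) / 2) * (lam i * z ^ 2)) ∂gaussianReal 0 1 :=
        integral_fintype_prod_eq_prod
          (f := fun i z => Real.exp (-((u - 1) / 2) * (lam i * z ^ 2)))
    _ = ∏ i, u ^ (-(lam i / 2)) := by
        refine Finset.prod_congr rfl fun i _ => ?_
        rcases hlam01 i with h | h
        · simp [h]
        · simp only [h, one_mul]; exact integral_exp_sq_gaussianReal hu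
    _ = u ^ (-(M.trace / 2)) := by
        rw [← Real.rpow_sum_of_pos (by linarith), htr, Finset.sum_neg_distrib, Finset.sum_div]

/-- `1 / r` as a Laplace integral; both sides are `∞` for `r = 0`. -/
theorem lintegral_exp_eq_inv {r : ℝ} (hr : 0 ≤ r) :
    ∫⁻ u in Set.Ioi (1 : ℝ), ENNReal.ofReal (1 / 2 * Real.exp (-((u - 1) / 2) * r))
      = (ENNReal.ofReal r)⁻¹ := by
  rcases hr.eq_or_lt with rfl | hr
  · simp
  · have h : ∀ u : ℝ, 1 / 2 * Real.exp (-((u - 1) / 2) * r)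
        = (1 / 2 * Real.exp (r / 2)) * Real.exp (-(r / 2) * u) := by
      intro u; rw [mul_assoc, ← Real.exp_add]; ring_nf
    simp_rw [h]
    rw [← ofReal_integral_eq_lintegral_ofReal, integral_const_mul,
      integral_exp_mul_Ioi (by linarith), ← ENNReal.ofReal_inv_of_pos hr]
    · congr 1
      rw [mul_one, neg_div_neg_eq, mul_div_assoc', mul_assoc, ← Real.exp_add]
      simp; field_simp
    · exact (integrableOn_exp_mul_Ioi (by linarith) 1).const_mul _
    · exact Filter.Eventually.of_forall fun u => by positivity

/-- The Laplace transform of the chi-square law with `d` degrees of freedom, integrated against the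
kernel of `lintegral_exp_eq_inv`. -/
theorem lintegral_rpow_Ioi_one {d : ℝ} (hd : 2 < d) :
    ∫⁻ u in Set.Ioi (1 : ℝ), ENNReal.ofReal (1 / 2 * u ^ (-(d / 2)))
      = ENNReal.ofReal (1 / (d - 2)) := by
  rw [← ofReal_integral_eq_lintegral_ofReal, integral_const_mul,
    integral_Ioi_rpow_of_lt (by linarith) one_pos]
  · congr 1
    rw [Real.one_rpow]
    have h1 : d - 2 ≠ 0 := by linarith
    rw [show -(d / 2) + 1 = -((d - 2) / 2) by ring]
    field_simp
  · exact (integrableOn_Ioi_rpow_of_lt (by linarith) one_pos).const_mul _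
  · refine (ae_restrict_iff' measurableSet_Ioi).2 (Filter.Eventually.of_forall fun u hu => ?_)
    have : (0 : ℝ) < u := lt_trans one_pos hu
    simp only [Pi.zero_apply]; positivity

theorem quadraticForm_nonneg {M : Matrix (Fin p) (Fin p) ℝ} (hs : Mᵀ = M)
    (hi : M * M = M) (x : Fin p → ℝ) : 0 ≤ x ⬝ᵥ (M *ᵥ x) := by
  have : x ⬝ᵥ (M *ᵥ x) = (M *ᵥ x) ⬝ᵥ (M *ᵥ x) := by
    conv_lhs => rw [← hi, ← Matrix.mulVec_mulVec, Matrix.dotProduct_mulVec,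
      ← Matrix.mulVec_transpose, hs]
  rw [this]
  exact Finset.sum_nonneg fun i _ => mul_self_nonneg _

/-- The mean of an inverse chi-square variable with `d > 2` degrees of freedom is `1 / (d - 2)`. -/
theorem lintegral_inv_quadraticForm {M : Matrix (Fin p) (Fin p) ℝ} (hs : Mᵀ = M)
    (hi : M * M = M) (hd : 2 < M.trace) :
    ∫⁻ x, (ENNReal.ofReal (x ⬝ᵥ (M *ᵥ x)))⁻¹ ∂gaussVec p = ENNReal.ofReal (1 / (M.trace - 2)) := by
  have hcont : Continuous fun x : Fin p → ℝ => x ⬝ᵥ (M *ᵥ x) :=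
    continuous_id.dotProduct (continuous_const.matrix_mulVec continuous_id)
  simp_rw [← lintegral_exp_eq_inv (quadraticForm_nonneg hs hi _)]
  rw [lintegral_lintegral_swap (by
    refine Measurable.aemeasurable (Continuous.measurable ?_)
    exact ENNReal.continuous_ofReal.comp (continuous_const.mul
      (Real.continuous_exp.comp ((by fun_prop : Continuous fun q : (Fin p → ℝ) × ℝ =>
        -((q.2 - 1) / 2)).mul (hcont.comp continuous_fst)))))]
  rw [← lintegral_rpow_Ioi_one hd]
  refine setLIntegral_congr_fun measurableSet_Ioi fun u hu => ?_
  have hu1 : (1 : ℝ) ≤ u := le_of_lt hu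
  rw [← ofReal_integral_eq_lintegral_ofReal, integral_const_mul,
    integral_exp_quadraticForm hs hi hu1]
  · refine Integrable.of_bound (C := 1 / 2) (Continuous.aestronglyMeasurable (by fun_prop)) ?_
    refine Filter.Eventually.of_forall fun x => ?_
    rw [Real.norm_of_nonneg (by positivity)]
    have : Real.exp (-((u - 1) / 2) * (x ⬝ᵥ (M *ᵥ x))) ≤ 1 := by
      rw [Real.exp_le_one_iff]
      have := quadraticForm_nonneg hs hi x
      nlinarith
    linarith
  · exact Filter.Eventually.of_forall fun x => by positivity

/-- The inverse of the form, taken in `[0, ∞]`, has a finite mean, and it is `∞` where the form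
vanishes. -/
theorem ae_quadraticForm_ne_zero {M : Matrix (Fin p) (Fin p) ℝ} (hs : Mᵀ = M)
    (hi : M * M = M) (hd : 2 < M.trace) : ∀ᵐ x ∂gaussVec p, x ⬝ᵥ (M *ᵥ x) ≠ 0 := by
  have hcont : Continuous fun x : Fin p → ℝ => x ⬝ᵥ (M *ᵥ x) :=
    continuous_id.dotProduct (continuous_const.matrix_mulVec continuous_id)
  have h := ae_lt_top (μ := gaussVec p) (f := fun x => (ENNReal.ofReal (x ⬝ᵥ (M *ᵥ x)))⁻¹)
    (by fun_prop) (by rw [lintegral_inv_quadraticForm hs hi hd]; exact ENNReal.ofReal_ne_top)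
  filter_upwards [h] with x hx h0
  simp [h0] at hx

end GaussVec

/-! ### Measurability of matrix expressions -/

section Measurability

variable {α : Type*} {mα : MeasurableSpace α}

theorem measurable_matrix_mul_apply {l m n : Type*} [Fintype m] {A : α → Matrix l m ℝ}
    {B : α → Matrix m n ℝ} (hA : ∀ i j, Measurable fun a => A a i j)
    (hB : ∀ i j, Measurable fun a => B a i j) (i : l) (j : n) :
    Measurable fun a => (A a * B a) i j := by
  simp only [Matrix.mul_apply]
  exact Finset.measurable_sum _ fun k _ => (hA i k).mul (hB k j)

theorem measurable_matrix_det {n : Type*} [Fintype n] [DecidableEq n] {A : α → Matrix n n ℝ}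
    (hA : ∀ i j, Measurable fun a => A a i j) : Measurable fun a => (A a).det := by
  simp only [Matrix.det_apply']
  exact Finset.measurable_sum _ fun s _ =>
    measurable_const.mul (Finset.measurable_prod _ fun i _ => hA _ _)

theorem measurable_matrix_inv_apply {n : Type*} [Fintype n] [DecidableEq n]
    {A : α → Matrix n n ℝ} (hA : ∀ i j, Measurable fun a => A a i j) (i j : n) :
    Measurable fun a => (A a)⁻¹ i j := by
  simp only [Matrix.inv_def, Matrix.smul_apply, Ring.inverse_eq_inv', smul_eq_mul,
    Matrix.adjugate_apply]
  refine (measurable_matrix_det hA).inv.mul (measurable_matrix_det fun k l => ?_)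
  by_cases h : k = j
  · subst h; simp
  · simpa [Matrix.updateRow_ne h] using hA k l

theorem measurable_gram_apply {n p : ℕ} {X : α → Matrix (Fin n) (Fin p) ℝ}
    (hX : ∀ i j, Measurable fun a => X a i j) (i j : Fin n) :
    Measurable fun a => (X a * (X a)ᵀ) i j :=
  measurable_matrix_mul_apply hX (fun i j => hX j i) i j

theorem measurable_rightInv_apply {n p : ℕ} {X : α → Matrix (Fin n) (Fin p) ℝ}
    (hX : ∀ i j, Measurable fun a => X a i j) (i : Fin p) (j : Fin n) :
    Measurable fun a => rightInv (X a) i j :=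
  measurable_matrix_mul_apply (fun i j => hX j i)
    (measurable_matrix_inv_apply (measurable_gram_apply hX)) i j

theorem measurable_rightInv_mul_apply {n p : ℕ} {X : α → Matrix (Fin n) (Fin p) ℝ}
    (hX : ∀ i j, Measurable fun a => X a i j) (i j : Fin p) :
    Measurable fun a => (rightInv (X a) * X a) i j :=
  measurable_matrix_mul_apply (measurable_rightInv_apply hX) hX i j

end Measurability

/-! ### Standard Gaussian matrices -/

/-- The law of an `n × p` matrix with independent standard Gaussian entries, as a product over
the rows. -/
abbrev gaussMat (n p : ℕ) : Measure (Fin n → Fin p → ℝ) := Measure.pi fun _ => gaussVec p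

section GaussMat

variable {n p : ℕ}

theorem measurable_of_apply (i : Fin n) (j : Fin p) :
    Measurable fun X : Fin n → Fin p → ℝ => Matrix.of X i j := by
  simp only [Matrix.of_apply]; fun_prop

theorem trace_one_sub_rightInv_mul {Y : Matrix (Fin n) (Fin p) ℝ} (hY : IsUnit (Y * Yᵀ).det) :
    (1 - rightInv Y * Y).trace = (p : ℝ) - n := by
  rw [Matrix.trace_sub, trace_rightInv_mul hY]; simp

theorem one_sub_rightInv_mul_transpose (Y : Matrix (Fin n) (Fin p) ℝ) :
    (1 - rightInv Y * Y)ᵀ = 1 - rightInv Y * Y := by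
  rw [Matrix.transpose_sub, rightInv_mul_transpose, Matrix.transpose_one]

/-- Splitting off the row `i` of a Gaussian matrix. -/
theorem measurePreserving_insertRow (i : Fin (n + 1)) :
    MeasurePreserving (fun q : (Fin p → ℝ) × (Fin n → Fin p → ℝ) =>
        (Fin.insertNth (α := fun _ => Fin p → ℝ) i q.1 q.2 : Fin (n + 1) → Fin p → ℝ))
      ((gaussVec p).prod (gaussMat n p)) (gaussMat (n + 1) p) :=
  (measurePreserving_piFinSuccAbove (fun _ : Fin (n + 1) => gaussVec p) i).symm

theorem two_lt_trace_one_sub {Y : Matrix (Fin n) (Fin p) ℝ} (hY : IsUnit (Y * Yᵀ).det)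
    (hnp : n + 2 < p) : 2 < (1 - rightInv Y * Y).trace := by
  have : (n : ℝ) + 2 < p := by exact_mod_cast hnp
  rw [trace_one_sub_rightInv_mul hY]; linarith

theorem ae_residual_ne_zero {Y : Matrix (Fin n) (Fin p) ℝ} (hY : IsUnit (Y * Yᵀ).det)
    (hnp : n + 2 < p) : ∀ᵐ x ∂gaussVec p, residual Y x ≠ 0 :=
  ae_quadraticForm_ne_zero (one_sub_rightInv_mul_transpose Y) (one_sub_rightInv_mul_idem hY)
    (two_lt_trace_one_sub hY hnp)

/-- A Gaussian matrix almost surely has full row rank. -/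
theorem ae_isUnit_det_gram (hnp : n + 1 < p) :
    ∀ᵐ X ∂gaussMat n p, IsUnit (Matrix.of X * (Matrix.of X)ᵀ).det := by
  induction n with
  | zero => exact Filter.Eventually.of_forall fun X => by simp
  | succ n ih =>
    have hmp := measurePreserving_insertRow (n := n) (p := p) 0
    have hmeas : MeasurableSet {X : Fin (n + 1) → Fin p → ℝ |
        IsUnit (Matrix.of X * (Matrix.of X)ᵀ).det} := by
      simp only [isUnit_iff_ne_zero]
      exact (measurable_matrix_det (measurable_gram_apply measurable_of_apply))
        (measurableSet_singleton (0 : ℝ)).compl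
    rw [← hmp.map_eq, ae_map_iff hmp.measurable.aemeasurable hmeas]
    refine (Measure.ae_prod_iff_ae_ae (hmp.measurable hmeas)).2
      ((Measure.ae_ae_comm (p := fun x Y => IsUnit (insertRow 0 x (Matrix.of Y) *
        (insertRow 0 x (Matrix.of Y))ᵀ).det) (hmp.measurable hmeas)).2 ?_)
    filter_upwards [ih (by omega)] with Y hY
    filter_upwards [ae_residual_ne_zero hY (by omega)] with x hx
    exact isUnit_det_gram_insertNth hY hx 0

/-- The mean of a diagonal entry of an inverse Wishart matrix: given the other rows, the entry is
the inverse of a chi-square variable with `p - n` degrees of freedom. -/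
theorem lintegral_gram_inv_apply (hnp : n + 2 < p) (i : Fin (n + 1)) :
    ∫⁻ X, ENNReal.ofReal ((Matrix.of X * (Matrix.of X)ᵀ)⁻¹ i i) ∂gaussMat (n + 1) p
      = ENNReal.ofReal (1 / ((p : ℝ) - n - 2)) := by
  have hmp := measurePreserving_insertRow (n := n) (p := p) i
  have hmeas : Measurable fun X : Fin (n + 1) → Fin p → ℝ =>
      ENNReal.ofReal ((Matrix.of X * (Matrix.of X)ᵀ)⁻¹ i i) :=
    (measurable_matrix_inv_apply (measurable_gram_apply measurable_of_apply) i i).ennreal_ofReal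
  rw [← hmp.lintegral_comp hmeas]
  refine (lintegral_prod_symm' _ (hmeas.comp hmp.measurable)).trans ?_
  rw [lintegral_congr_ae (g := fun _ => ENNReal.ofReal (1 / ((p : ℝ) - n - 2))),
    lintegral_const, measure_univ, mul_one]
  filter_upwards [ae_isUnit_det_gram (n := n) (p := p) (by omega)] with Y hY
  have hd := two_lt_trace_one_sub hY hnp
  have h := lintegral_inv_quadraticForm (one_sub_rightInv_mul_transpose (Matrix.of Y))
    (one_sub_rightInv_mul_idem hY) hd
  rw [trace_one_sub_rightInv_mul hY] at h
  rw [← h]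
  refine lintegral_congr_ae ?_
  filter_upwards [ae_residual_ne_zero hY hnp] with x hx
  have hpos : 0 < residual (Matrix.of Y) x :=
    lt_of_le_of_ne (quadraticForm_nonneg (one_sub_rightInv_mul_transpose (Matrix.of Y))
      (one_sub_rightInv_mul_idem hY) x) hx.symm
  have := gram_inv_insertNth_apply hY hx i
  change ENNReal.ofReal ((insertRow i x (Matrix.of Y) * (insertRow i x (Matrix.of Y))ᵀ)⁻¹ i i) = _
  rw [this, ENNReal.ofReal_inv_of_pos hpos]
  rfl

theorem gram_inv_apply_self_nonneg (X : Matrix (Fin n) (Fin p) ℝ) (i : Fin n) :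
    0 ≤ (X * Xᵀ)⁻¹ i i := by
  have h : (X * Xᵀ).PosSemidef := by
    simpa [Matrix.conjTranspose_eq_transpose_of_trivial] using
      Matrix.posSemidef_self_mul_conjTranspose X
  exact h.inv.diag_nonneg

/-- The mean of the trace of an inverse Wishart matrix with identity scale. -/
theorem integral_trace_gram_inv (hnp : n + 1 < p) :
    Integrable (fun X => ((Matrix.of X * (Matrix.of X)ᵀ)⁻¹).trace) (gaussMat n p) ∧
      ∫ X, ((Matrix.of X * (Matrix.of X)ᵀ)⁻¹).trace ∂gaussMat n p
        = n / ((p : ℝ) - (n + 1)) := by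
  rcases n with _ | n
  · simp [Matrix.trace]
  have hnp' : (n : ℝ) + 2 < p := by exact_mod_cast hnp
  have hmeas : ∀ i, Measurable fun X : Fin (n + 1) → Fin p → ℝ =>
      (Matrix.of X * (Matrix.of X)ᵀ)⁻¹ i i := fun i =>
    measurable_matrix_inv_apply (measurable_gram_apply measurable_of_apply) i i
  have hint : ∀ i, Integrable (fun X : Fin (n + 1) → Fin p → ℝ =>
      (Matrix.of X * (Matrix.of X)ᵀ)⁻¹ i i) (gaussMat (n + 1) p) := fun i => by
    refine ⟨(hmeas i).aestronglyMeasurable, ?_⟩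
    rw [hasFiniteIntegral_iff_ofReal
      (Filter.Eventually.of_forall fun X => gram_inv_apply_self_nonneg _ i),
      lintegral_gram_inv_apply hnp i]
    exact ENNReal.ofReal_lt_top
  have hval : ∀ i, ∫ X, (Matrix.of X * (Matrix.of X)ᵀ)⁻¹ i i ∂gaussMat (n + 1) p
      = 1 / ((p : ℝ) - n - 2) := fun i => by
    rw [integral_eq_lintegral_of_nonneg_ae
      (Filter.Eventually.of_forall fun X => gram_inv_apply_self_nonneg _ i)
      (hmeas i).aestronglyMeasurable, lintegral_gram_inv_apply hnp i, ENNReal.toReal_ofReal]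
    exact one_div_nonneg.2 (by linarith)
  simp only [Matrix.trace, Matrix.diag_apply]
  refine ⟨integrable_finsetSum _ fun i _ => hint i, ?_⟩
  rw [integral_finsetSum _ fun i _ => hint i]
  simp only [hval, Finset.sum_const, Finset.card_univ, Fintype.card_fin, nsmul_eq_mul]
  push_cast
  rw [mul_one_div]
  congr 1; ring

/-! ### The mean projection onto the row space -/

theorem rightInv_mul_right_orthogonal {U : Matrix (Fin p) (Fin p) ℝ} (hU : Uᵀ * U = 1)
    (X : Matrix (Fin n) (Fin p) ℝ) :
    rightInv (X * Uᵀ) * (X * Uᵀ) = U * (rightInv X * X) * Uᵀ := by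
  have h : X * Uᵀ * (X * Uᵀ)ᵀ = X * Xᵀ := by
    rw [Matrix.transpose_mul, Matrix.transpose_transpose, Matrix.mul_assoc,
      ← Matrix.mul_assoc Uᵀ, hU, Matrix.one_mul]
  rw [rightInv, h, rightInv, Matrix.transpose_mul, Matrix.transpose_transpose]
  simp only [Matrix.mul_assoc]

theorem measurePreserving_gaussMat_of_orthogonal {U : Matrix (Fin p) (Fin p) ℝ}
    (hU : Uᵀ * U = 1) :
    MeasurePreserving (fun (X : Fin n → Fin p → ℝ) i => U *ᵥ X i) (gaussMat n p)
      (gaussMat n p) :=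
  measurePreserving_pi _ _ fun _ => measurePreserving_gaussVec_of_orthogonal hU

theorem measurable_proj_apply (i j : Fin p) : Measurable fun X : Fin n → Fin p → ℝ =>
    (rightInv (Matrix.of X) * Matrix.of X) i j :=
  measurable_rightInv_mul_apply measurable_of_apply i j

theorem integrable_proj_apply (hnp : n + 1 < p) (i j : Fin p) :
    Integrable (fun X => (rightInv (Matrix.of X) * Matrix.of X) i j) (gaussMat n p) := by
  refine Integrable.of_bound (C := 1) (measurable_proj_apply i j).aestronglyMeasurable ?_
  filter_upwards [ae_isUnit_det_gram hnp] with X hX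
  exact abs_rightInv_mul_le hX i j

/-- The mean projection is invariant under conjugation by orthogonal matrices. -/
theorem integral_proj_conj {U : Matrix (Fin p) (Fin p) ℝ} (hU : Uᵀ * U = 1) (i j : Fin p) :
    ∫ X, (rightInv (Matrix.of X) * Matrix.of X) i j ∂gaussMat n p
      = ∫ X, (U * (rightInv (Matrix.of X) * Matrix.of X) * Uᵀ) i j ∂gaussMat n p := by
  have hmp := measurePreserving_gaussMat_of_orthogonal (n := n) hU
  conv_lhs => rw [← hmp.map_eq]
  rw [integral_map hmp.measurable.aemeasurable (measurable_proj_apply i j).aestronglyMeasurable]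
  refine integral_congr_ae (Filter.Eventually.of_forall fun X => ?_)
  have h : Matrix.of (fun i => U *ᵥ X i) = Matrix.of X * Uᵀ := by
    ext i j; simp [Matrix.mul_apply, Matrix.mulVec, dotProduct, mul_comm]
  simp only
  rw [h, rightInv_mul_right_orthogonal hU]

theorem integral_proj_apply_of_ne {i j : Fin p} (hij : i ≠ j) :
    ∫ X, (rightInv (Matrix.of X) * Matrix.of X) i j ∂gaussMat n p = 0 := by
  -- conjugation by the reflection of the coordinate `i` changes the sign of the entry `(i, j)`
  set U : Matrix (Fin p) (Fin p) ℝ := Matrix.diagonal fun k => if k = i then -1 else 1 with hUdef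
  have hU : Uᵀ * U = 1 := by
    rw [hUdef, Matrix.diagonal_transpose, Matrix.diagonal_mul_diagonal, ← Matrix.diagonal_one]
    congr 1; ext k; split_ifs <;> simp
  have h := integral_proj_conj (n := n) hU i j
  have h2 : ∀ X : Fin n → Fin p → ℝ,
      (U * (rightInv (Matrix.of X) * Matrix.of X) * Uᵀ) i j
        = -(rightInv (Matrix.of X) * Matrix.of X) i j := by
    intro X
    rw [hUdef, Matrix.diagonal_transpose, Matrix.mul_diagonal, Matrix.diagonal_mul]
    simp [hij.symm]
  simp only [h2, integral_neg] at h
  linarith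

theorem integral_proj_apply_self_eq (i j : Fin p) :
    ∫ X, (rightInv (Matrix.of X) * Matrix.of X) i i ∂gaussMat n p
      = ∫ X, (rightInv (Matrix.of X) * Matrix.of X) j j ∂gaussMat n p := by
  set U : Matrix (Fin p) (Fin p) ℝ := (Equiv.swap i j).permMatrix ℝ with hUdef
  have hUt : Uᵀ = (Equiv.swap i j).permMatrix ℝ := by
    rw [hUdef, Matrix.transpose_permMatrix, Equiv.swap_inv]
  have hU : Uᵀ * U = 1 := by
    rw [hUt, hUdef, ← Matrix.permMatrix_mul, Equiv.swap_mul_self, Matrix.permMatrix_one]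
  rw [integral_proj_conj (n := n) hU i i]
  refine integral_congr_ae (Filter.Eventually.of_forall fun X => ?_)
  simp only [hUt]
  rw [hUdef, Equiv.Perm.permMatrix, PEquiv.mul_toMatrix_toPEquiv, Matrix.submatrix_apply,
    PEquiv.toMatrix_toPEquiv_mul, Matrix.submatrix_apply]
  simp

/-- `𝔼 H = (n / p) I`: the mean is a multiple of the identity by invariance under signed
permutations of the coordinates, and `tr H = n`. -/
theorem integral_proj_apply (hnp : n + 1 < p) (i j : Fin p) :
    ∫ X, (rightInv (Matrix.of X) * Matrix.of X) i j ∂gaussMat n p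
      = (n : ℝ) / p * (1 : Matrix (Fin p) (Fin p) ℝ) i j := by
  rcases eq_or_ne i j with rfl | hij
  · have hp : (p : ℝ) ≠ 0 := by
      have : 0 < p := by omega
      positivity
    have h : ∑ k, ∫ X, (rightInv (Matrix.of X) * Matrix.of X) k k ∂gaussMat n p = n := by
      rw [← integral_finsetSum _ fun k _ => integrable_proj_apply hnp k k]
      rw [integral_congr_ae (g := fun _ => (n : ℝ))]
      · simp
      · filter_upwards [ae_isUnit_det_gram hnp] with X hX
        exact trace_rightInv_mul hX
    rw [Finset.sum_congr rfl fun k _ => integral_proj_apply_self_eq k i] at h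
    simp only [Finset.sum_const, Finset.card_univ, Fintype.card_fin, nsmul_eq_mul] at h
    rw [Matrix.one_apply_eq, mul_one]
    field_simp
    linarith
  · rw [integral_proj_apply_of_ne hij, Matrix.one_apply_ne hij, mul_zero]

end GaussMat

/-! ### Conditional moments of an estimator that is affine in an independent noise -/

section CondMoments

variable {Ω : Type*} {m mε mΩ : MeasurableSpace Ω} {μ : Measure Ω}

theorem indepFun_of_indep (hind : Indep mε m μ) {f g : Ω → ℝ} (hf : Measurable[m] f)
    (hg : Measurable[mε] g) : IndepFun f g μ := by
  rw [IndepFun_iff_Indep]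
  exact (indep_of_indep_of_le_left (indep_of_indep_of_le_right hind hf.comap_le)
    hg.comap_le).symm

variable [IsProbabilityMeasure μ]

theorem condExp_mul_of_indep (hm : m ≤ mΩ) (hmε : mε ≤ mΩ) (hind : Indep mε m μ)
    {f g : Ω → ℝ} (hf : Measurable[m] f) (hfi : Integrable f μ) (hg : Measurable[mε] g)
    (hgi : Integrable g μ) : μ[f * g | m] =ᵐ[μ] fun ω => f ω * ∫ ω', g ω' ∂μ := by
  have h1 := condExp_mul_of_stronglyMeasurable_left hf.stronglyMeasurable
    ((indepFun_of_indep hind hf hg).integrable_mul hfi hgi) hgi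
  have h2 := condExp_indep_eq hmε hm hg.stronglyMeasurable hind
  filter_upwards [h1, h2] with ω h1 h2
  rw [h1, Pi.mul_apply, h2]

/-- A random vector `b = a + B e` whose coefficients `a`, `B` are measurable with respect to `m`,
while `e` is a vector of centred uncorrelated variables with standard deviations `s` that is
independent of `m` (being measurable with respect to `mε`). -/
structure AffineInNoise (μ : Measure Ω) (m mε : MeasurableSpace Ω) {p : ℕ} {K : Type*} [Fintype K]
    (b : Ω → EuclideanSpace ℝ (Fin p)) (a : Ω → Fin p → ℝ) (B : Ω → Fin p → K → ℝ)
    (e : Ω → K → ℝ) (s : K → ℝ) : Prop where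
  indep : Indep mε m μ
  measurable_coeff : ∀ i, Measurable[m] fun ω => a ω i
  integrable_coeff : ∀ i, Integrable (fun ω => a ω i) μ
  measurable_lin : ∀ i k, Measurable[m] fun ω => B ω i k
  memLp_lin : ∀ i k, MemLp (fun ω => B ω i k) 2 μ
  measurable_noise : ∀ k, Measurable[mε] fun ω => e ω k
  memLp_noise : ∀ k, MemLp (fun ω => e ω k) 2 μ
  mean_noise : ∀ k, ∫ ω, e ω k ∂μ = 0
  var_noise : ∀ k, ∫ ω, e ω k * e ω k ∂μ = s k ^ 2
  cov_noise : ∀ k l, k ≠ l → ∫ ω, e ω k * e ω l ∂μ = 0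
  eq_ae : ∀ᵐ ω ∂μ, ∀ i, b ω i = a ω i + ∑ k, B ω i k * e ω k

variable {p : ℕ} {K : Type*} [Fintype K] {b : Ω → EuclideanSpace ℝ (Fin p)}
  {a : Ω → Fin p → ℝ} {B : Ω → Fin p → K → ℝ} {e : Ω → K → ℝ} {s : K → ℝ}

theorem AffineInNoise.condMean_ae (hm : m ≤ mΩ) (hmε : mε ≤ mΩ)
    (h : AffineInNoise μ m mε b a B e s) :
    ∀ᵐ ω ∂μ, ∀ i, condMean μ m b ω i = a ω i := by
  rw [ae_all_iff]
  intro i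
  have hBi : ∀ k, Integrable (fun ω => B ω i k) μ := fun k =>
    (h.memLp_lin i k).integrable one_le_two
  have hei : ∀ k, Integrable (fun ω => e ω k) μ := fun k =>
    (h.memLp_noise k).integrable one_le_two
  have hint : ∀ k, Integrable ((fun ω => B ω i k) * fun ω => e ω k) μ := fun k =>
    (indepFun_of_indep h.indep (h.measurable_lin i k) (h.measurable_noise k)).integrable_mul
      (hBi k) (hei k)
  have h1 : (fun ω => b ω i) =ᵐ[μ]
      (fun ω => a ω i) + ∑ k, ((fun ω => B ω i k) * fun ω => e ω k) := by
    filter_upwards [h.eq_ae] with ω hω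
    simp [hω i]
  have h2 := condExp_congr_ae (m := m) h1
  have h3 := condExp_add (h.integrable_coeff i)
    (integrable_finsetSum' Finset.univ fun k _ => hint k) m
  have h4 := condExp_finsetSum (s := Finset.univ) (fun k _ => hint k) m
  have h5 : ∀ᵐ ω ∂μ, ∀ k, (μ[(fun ω => B ω i k) * fun ω => e ω k | m]) ω = 0 := by
    rw [ae_all_iff]
    intro k
    filter_upwards [condExp_mul_of_indep hm hmε h.indep (h.measurable_lin i k) (hBi k)
      (h.measurable_noise k) (hei k)] with ω hω
    rw [hω, h.mean_noise, mul_zero]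
  have h6 := condExp_of_stronglyMeasurable hm (h.measurable_coeff i).stronglyMeasurable
    (h.integrable_coeff i)
  filter_upwards [h2, h3, h4, h5] with ω h2 h3 h4 h5
  rw [condMean, h2, h3, Pi.add_apply, h4, h6, Finset.sum_apply]
  simp [h5]

theorem AffineInNoise.condVariance_ae (hm : m ≤ mΩ) (hmε : mε ≤ mΩ)
    (h : AffineInNoise μ m mε b a B e s) :
    ∀ᵐ ω ∂μ, condVariance μ m 1 b ω = ∑ i, ∑ k, s k ^ 2 * B ω i k ^ 2 := by
  have key : ∀ i, ∀ᵐ ω ∂μ, condCov μ m b ω i i = ∑ k, s k ^ 2 * B ω i k ^ 2 := by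
    intro i
    have hBB : ∀ k l, Integrable (fun ω => B ω i k * B ω i l) μ := fun k l =>
      (h.memLp_lin i k).integrable_mul (h.memLp_lin i l)
    have hee : ∀ k l, Integrable (fun ω => e ω k * e ω l) μ := fun k l =>
      (h.memLp_noise k).integrable_mul (h.memLp_noise l)
    have hBm : ∀ k l, Measurable[m] (fun ω => B ω i k * B ω i l) := fun k l =>
      (h.measurable_lin i k).mul (h.measurable_lin i l)
    have hem : ∀ k l, Measurable[mε] (fun ω => e ω k * e ω l) := fun k l =>
      (h.measurable_noise k).mul (h.measurable_noise l)
    set F : K × K → Ω → ℝ := fun q =>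
      (fun ω => B ω i q.1 * B ω i q.2) * fun ω => e ω q.1 * e ω q.2 with hF
    have hint : ∀ q, Integrable (F q) μ := fun q =>
      (indepFun_of_indep h.indep (hBm _ _) (hem _ _)).integrable_mul (hBB _ _) (hee _ _)
    have h1 : (fun ω => (b ω i - condMean μ m b ω i) * (b ω i - condMean μ m b ω i))
        =ᵐ[μ] ∑ q, F q := by
      filter_upwards [h.eq_ae, h.condMean_ae hm hmε] with ω h1 h2
      rw [h1, h2, add_sub_cancel_left, Finset.sum_mul_sum, Finset.sum_apply,
        Fintype.sum_prod_type]
      refine Finset.sum_congr rfl fun k _ => Finset.sum_congr rfl fun l _ => ?_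
      simp only [hF, Pi.mul_apply]; ring
    have h2 := condExp_congr_ae (m := m) h1
    have h3 := condExp_finsetSum (s := Finset.univ) (fun q _ => hint q) m
    have h4 : ∀ᵐ ω ∂μ, ∀ q : K × K, (μ[F q | m]) ω
        = B ω i q.1 * B ω i q.2 * ∫ ω', e ω' q.1 * e ω' q.2 ∂μ := by
      rw [ae_all_iff]
      exact fun q => condExp_mul_of_indep hm hmε h.indep (hBm _ _) (hBB _ _) (hem _ _) (hee _ _)
    filter_upwards [h2, h3, h4] with ω h2 h3 h4
    rw [condCov, Matrix.of_apply, h2, h3, Finset.sum_apply]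
    simp only [h4]
    rw [Fintype.sum_prod_type]
    refine Finset.sum_congr rfl fun k _ => ?_
    rw [Finset.sum_eq_single k, h.var_noise]
    · ring
    · intro l _ hl
      simp [h.cov_noise k l hl.symm]
    · simp
  filter_upwards [ae_all_iff.2 key] with ω hω
  rw [condVariance, Matrix.one_mul, Matrix.trace]
  exact Finset.sum_congr rfl fun i _ => hω i

theorem AffineInNoise.bias_ae (hm : m ≤ mΩ) (hmε : mε ≤ mΩ)
    (h : AffineInNoise μ m mε b a B e s) (β : EuclideanSpace ℝ (Fin p)) :
    ∀ᵐ ω ∂μ, bias μ m 1 β b ω = (a ω - β.ofLp) ⬝ᵥ (a ω - β.ofLp) := by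
  filter_upwards [h.condMean_ae hm hmε] with ω hω
  rw [bias, Matrix.one_mulVec, show condMean μ m b ω = a ω from funext hω]

end CondMoments

/-! ### Bias and variance of the interpolators for designs of full row rank -/

section ClosedForms

variable {n n₀ n₁ p : ℕ}

theorem sum_sq_eq_trace {l m : Type*} [Fintype l] [Fintype m] (A : Matrix l m ℝ) :
    ∑ i, ∑ k, A i k ^ 2 = (A * Aᵀ).trace := by
  simp [Matrix.trace, Matrix.mul_apply, sq]

theorem dotProduct_mulVec_self_of_symm_idem {M : Matrix (Fin p) (Fin p) ℝ} (hs : Mᵀ = M)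
    (hi : M * M = M) (x : Fin p → ℝ) : (M *ᵥ x) ⬝ᵥ (M *ᵥ x) = x ⬝ᵥ (M *ᵥ x) := by
  rw [Matrix.dotProduct_mulVec, ← Matrix.mulVec_transpose, hs, Matrix.mulVec_mulVec, hi,
    dotProduct_comm]

theorem dotProduct_mulVec_eq_trace (M : Matrix (Fin p) (Fin p) ℝ) (x : Fin p → ℝ) :
    x ⬝ᵥ (M *ᵥ x) = (M * Matrix.vecMulVec x x).trace := by
  rw [Matrix.mul_vecMulVec, Matrix.trace_vecMulVec, dotProduct_comm]

theorem varMNI_one {X : Matrix (Fin n) (Fin p) ℝ} (hX : IsUnit (X * Xᵀ).det) (s : ℝ) :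
    varMNI 1 X s = s ^ 2 * ((X * Xᵀ)⁻¹).trace := by
  rw [varMNI, smul_trace_pinv_sampleCov hX, Matrix.mul_one, Matrix.trace_mul_comm,
    rightInv_transpose_mul_self hX]

theorem varInflation_one {X₀ : Matrix (Fin n₀) (Fin p) ℝ} {X₁ : Matrix (Fin n₁) (Fin p) ℝ}
    (h₀ : IsUnit (X₀ * X₀ᵀ).det) (h₁ : IsUnit (X₁ * X₁ᵀ).det) (s : ℝ) :
    varInflation 1 X₀ X₁ s
      = s ^ 2 * ((1 - rightInv X₀ * X₀) * (rightInv X₁ * (rightInv X₁)ᵀ)).trace := by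
  rw [varInflation, smul_trace_pinv_sampleCov h₁, nullCov_one h₀, Matrix.trace_mul_comm]

theorem biasMNI_one {X : Matrix (Fin n) (Fin p) ℝ} (hX : IsUnit (X * Xᵀ).det)
    (β : EuclideanSpace ℝ (Fin p)) :
    biasMNI 1 X β = β.ofLp ⬝ᵥ ((1 - rightInv X * X) *ᵥ β.ofLp) := by
  rw [biasMNI, nullCov_one hX]

/-- The error `H₁ δ - (I - H₁) β` of the conditional mean of the source interpolator as an
estimator of the target coefficients `β`. -/
def sourceError (X₁ : Matrix (Fin n₁) (Fin p) ℝ) (β δ : EuclideanSpace ℝ (Fin p)) : Fin p → ℝ :=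
  (rightInv X₁ * X₁) *ᵥ δ.ofLp - (1 - rightInv X₁ * X₁) *ᵥ β.ofLp

theorem measurable_sourceError {Ω : Type*} {m : MeasurableSpace Ω}
    {X : Ω → Matrix (Fin n) (Fin p) ℝ}
    (hX : ∀ i j, Measurable fun ω => X ω i j) (β δ : EuclideanSpace ℝ (Fin p)) (i : Fin p) :
    Measurable fun ω => sourceError (X ω) β δ i := by
  have hP := fun i j => measurable_rightInv_mul_apply hX i j
  simp only [sourceError, Pi.sub_apply, Matrix.mulVec, dotProduct, Matrix.sub_apply]
  exact (Finset.measurable_sum _ fun j _ => (hP i j).mul_const _).sub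
    (Finset.measurable_sum _ fun j _ => (measurable_const.sub (hP i j)).mul_const _)

/-- The closed form of the bias is a single quadratic form in the source error. -/
theorem biasTM_one {X₀ : Matrix (Fin n₀) (Fin p) ℝ} {X₁ : Matrix (Fin n₁) (Fin p) ℝ}
    (h₀ : IsUnit (X₀ * X₀ᵀ).det) (h₁ : IsUnit (X₁ * X₁ᵀ).det)
    (β δ : EuclideanSpace ℝ (Fin p)) :
    biasTM 1 X₀ X₁ β δ
      = sourceError X₁ β δ ⬝ᵥ ((1 - rightInv X₀ * X₀) *ᵥ sourceError X₁ β δ) := by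
  rw [biasTM, nullCov_one h₀, rowProj_eq_rightInv_mul h₁, sourceError]
  set N := 1 - rightInv X₀ * X₀ with hN
  set H := rightInv X₁ * X₁ with hH
  have hNs : Nᵀ = N := one_sub_rightInv_mul_transpose X₀
  have hHs : Hᵀ = H := rightInv_mul_transpose X₁
  have hMs : (1 - H)ᵀ = 1 - H := one_sub_rightInv_mul_transpose X₁
  have key : ∀ (A B : Matrix (Fin p) (Fin p) ℝ) (u v : Fin p → ℝ), Aᵀ = A →
      u ⬝ᵥ ((A * N * B) *ᵥ v) = (A *ᵥ u) ⬝ᵥ (N *ᵥ (B *ᵥ v)) := by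
    intro A B u v hA
    rw [← Matrix.mulVec_mulVec, ← Matrix.mulVec_mulVec, Matrix.dotProduct_mulVec,
      ← Matrix.mulVec_transpose, hA]
  rw [key _ _ _ _ hHs, key _ _ _ _ hHs, key _ _ _ _ hMs]
  have hsymm : ∀ u v : Fin p → ℝ, u ⬝ᵥ (N *ᵥ v) = v ⬝ᵥ (N *ᵥ u) := by
    intro u v
    rw [Matrix.dotProduct_mulVec, ← Matrix.mulVec_transpose, hNs, dotProduct_comm]
  generalize H *ᵥ δ.ofLp = u
  generalize (1 - H) *ᵥ β.ofLp = v
  simp only [Matrix.mulVec_sub, sub_dotProduct, dotProduct_sub]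
  rw [hsymm v u]
  ring

/-- `H₁ δ` and `(I - H₁) β` are orthogonal. -/
theorem sourceError_dotProduct_self {X₁ : Matrix (Fin n₁) (Fin p) ℝ} (h₁ : IsUnit (X₁ * X₁ᵀ).det)
    (β δ : EuclideanSpace ℝ (Fin p)) :
    sourceError X₁ β δ ⬝ᵥ sourceError X₁ β δ
      = δ.ofLp ⬝ᵥ ((rightInv X₁ * X₁) *ᵥ δ.ofLp)
        + β.ofLp ⬝ᵥ ((1 - rightInv X₁ * X₁) *ᵥ β.ofLp) := by
  rw [sourceError, sub_dotProduct, dotProduct_sub, dotProduct_sub,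
    dotProduct_mulVec_self_of_symm_idem (rightInv_mul_transpose X₁) (rightInv_mul_idem h₁),
    dotProduct_mulVec_self_of_symm_idem (one_sub_rightInv_mul_transpose X₁)
      (one_sub_rightInv_mul_idem h₁)]
  have h : ((rightInv X₁ * X₁) *ᵥ δ.ofLp) ⬝ᵥ ((1 - rightInv X₁ * X₁) *ᵥ β.ofLp) = 0 := by
    rw [dotProduct_comm, Matrix.dotProduct_mulVec, ← Matrix.mulVec_transpose,
      rightInv_mul_transpose, Matrix.mulVec_mulVec, Matrix.mul_sub, rightInv_mul_idem h₁]
    simp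
  have h' : ((1 - rightInv X₁ * X₁) *ᵥ β.ofLp) ⬝ᵥ ((rightInv X₁ * X₁) *ᵥ δ.ofLp) = 0 := by
    rw [dotProduct_comm, h]
  rw [h, h']
  ring

theorem mni_response {X : Matrix (Fin n) (Fin p) ℝ} (hX : IsUnit (X * Xᵀ).det)
    (β : EuclideanSpace ℝ (Fin p)) (e : Fin n → ℝ) :
    (mni X (X *ᵥ β.ofLp + e)).ofLp = (rightInv X * X) *ᵥ β.ofLp + rightInv X *ᵥ e := by
  rw [mni_eq hX, Matrix.mulVec_add, Matrix.mulVec_mulVec]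

theorem transferMNI_response {X₀ : Matrix (Fin n₀) (Fin p) ℝ} {X₁ : Matrix (Fin n₁) (Fin p) ℝ}
    (h₀ : IsUnit (X₀ * X₀ᵀ).det) (h₁ : IsUnit (X₁ * X₁ᵀ).det)
    (β₀ β₁ : EuclideanSpace ℝ (Fin p)) (e₀ : Fin n₀ → ℝ) (e₁ : Fin n₁ → ℝ) :
    (transferMNI X₀ (X₀ *ᵥ β₀.ofLp + e₀) X₁ (X₁ *ᵥ β₁.ofLp + e₁)).ofLp
      = (β₀.ofLp + (1 - rightInv X₀ * X₀) *ᵥ sourceError X₁ β₀ (β₁ - β₀))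
        + (rightInv X₀ *ᵥ e₀ + ((1 - rightInv X₀ * X₀) * rightInv X₁) *ᵥ e₁) := by
  rw [transferMNI, nearestInterpolator_eq h₀, mni_response h₁, sourceError]
  simp only [Matrix.mulVec_sub, Matrix.sub_mulVec, Matrix.mulVec_add, Matrix.one_mulVec,
    Matrix.mulVec_mulVec, WithLp.ofLp_sub, Matrix.sub_mul, Matrix.one_mul, Matrix.mul_assoc]
  abel

end ClosedForms

/-! ### Random Gaussian designs -/

section RandomDesign

variable {Ω : Type*} [mΩ : MeasurableSpace Ω] {μ : Measure Ω} {n p : ℕ}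
  {X : Ω → Matrix (Fin n) (Fin p) ℝ}

/-- The joint law of the entries, regrouped by rows. -/
theorem IsStdGaussianMatrix.measurePreserving (h : IsStdGaussianMatrix μ X)
    (hX : ∀ i j, Measurable fun ω => X ω i j) :
    MeasurePreserving (fun ω (i : Fin n) (j : Fin p) => X ω i j) μ (gaussMat n p) := by
  have hm : Measurable fun ω (a : Fin n × Fin p) => X ω a.1 a.2 :=
    measurable_pi_lambda _ fun a => hX a.1 a.2
  refine ⟨measurable_pi_lambda _ fun i => measurable_pi_lambda _ fun j => hX i j, ?_⟩
  have h1 : μ.map (fun ω (a : Fin n × Fin p) => X ω a.1 a.2)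
      = Measure.infinitePi fun _ : Fin n × Fin p => gaussianReal 0 1 := by
    rw [Measure.infinitePi_eq_pi]
    refine (h.indep.map_fun_eq_pi_map fun a : Fin n × Fin p => (hX a.1 a.2).aemeasurable).trans ?_
    congr 1
    ext1 a
    exact (h.law a.1 a.2).map_eq
  have h2 := Measure.infinitePi_map_curry (fun (_ : Fin n) (_ : Fin p) => gaussianReal 0 1)
  rw [← h1, Measure.map_map (by fun_prop) hm] at h2
  simp only [Measure.infinitePi_eq_pi] at h2
  exact h2

theorem IsStdGaussianMatrix.ae_isUnit_det (h : IsStdGaussianMatrix μ X)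
    (hX : ∀ i j, Measurable fun ω => X ω i j) (hnp : n + 1 < p) :
    ∀ᵐ ω ∂μ, IsUnit (X ω * (X ω)ᵀ).det :=
  (h.measurePreserving hX).quasiMeasurePreserving.ae (ae_isUnit_det_gram hnp)

theorem IsStdGaussianMatrix.integral_trace_gram_inv (h : IsStdGaussianMatrix μ X)
    (hX : ∀ i j, Measurable fun ω => X ω i j) (hnp : n + 1 < p) :
    Integrable (fun ω => ((X ω * (X ω)ᵀ)⁻¹).trace) μ ∧
      ∫ ω, ((X ω * (X ω)ᵀ)⁻¹).trace ∂μ = n / ((p : ℝ) - (n + 1)) := by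
  have hmp := h.measurePreserving hX
  obtain ⟨h1, h2⟩ := TransferMNI.integral_trace_gram_inv hnp
  refine ⟨hmp.integrable_comp_of_integrable h1, ?_⟩
  rw [← h2, ← hmp.map_eq, integral_map hmp.measurable.aemeasurable]
  · rfl
  · rw [hmp.map_eq]; exact h1.aestronglyMeasurable

theorem IsStdGaussianMatrix.integral_rightInv_mul (h : IsStdGaussianMatrix μ X)
    (hX : ∀ i j, Measurable fun ω => X ω i j) (hnp : n + 1 < p) (i j : Fin p) :
    ∫ ω, (rightInv (X ω) * X ω) i j ∂μ = (n : ℝ) / p * (1 : Matrix (Fin p) (Fin p) ℝ) i j := by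
  have hmp := h.measurePreserving hX
  rw [← integral_proj_apply hnp i j, ← hmp.map_eq, integral_map hmp.measurable.aemeasurable]
  · rfl
  · exact (measurable_proj_apply i j).aestronglyMeasurable

/-- `X†` is square integrable because `‖X†‖²` (Frobenius) is the trace of the inverse Gram
matrix. -/
theorem IsStdGaussianMatrix.memLp_rightInv (h : IsStdGaussianMatrix μ X)
    (hX : ∀ i j, Measurable fun ω => X ω i j) (hnp : n + 1 < p) (i : Fin p) (k : Fin n) :
    MemLp (fun ω => rightInv (X ω) i k) 2 μ := by
  have hm := measurable_rightInv_apply hX i k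
  rw [memLp_two_iff_integrable_sq hm.aestronglyMeasurable]
  refine (h.integral_trace_gram_inv hX hnp).1.mono' (hm.pow_const 2).aestronglyMeasurable ?_
  filter_upwards [h.ae_isUnit_det hX hnp] with ω hω
  rw [Real.norm_of_nonneg (sq_nonneg _), ← rightInv_transpose_mul_self hω, Matrix.trace_mul_comm,
    ← sum_sq_eq_trace]
  calc rightInv (X ω) i k ^ 2 ≤ ∑ k, rightInv (X ω) i k ^ 2 :=
        Finset.single_le_sum (f := fun k => rightInv (X ω) i k ^ 2) (fun _ _ => sq_nonneg _)
          (Finset.mem_univ k)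
    _ ≤ _ := Finset.single_le_sum (f := fun i => ∑ k, rightInv (X ω) i k ^ 2)
          (fun _ _ => Finset.sum_nonneg fun _ _ => sq_nonneg _) (Finset.mem_univ i)

theorem IsStdGaussianMatrix.integrable_rightInv_mul_transpose (h : IsStdGaussianMatrix μ X)
    (hX : ∀ i j, Measurable fun ω => X ω i j) (hnp : n + 1 < p) (i j : Fin p) :
    Integrable (fun ω => (rightInv (X ω) * (rightInv (X ω))ᵀ) i j) μ := by
  simp only [Matrix.mul_apply, Matrix.transpose_apply]
  exact integrable_finsetSum _ fun k _ =>
    (h.memLp_rightInv hX hnp i k).integrable_mul (h.memLp_rightInv hX hnp j k)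

theorem IsStdGaussianMatrix.integral_trace_rightInv_mul_transpose (h : IsStdGaussianMatrix μ X)
    (hX : ∀ i j, Measurable fun ω => X ω i j) (hnp : n + 1 < p) :
    ∫ ω, (rightInv (X ω) * (rightInv (X ω))ᵀ).trace ∂μ = n / ((p : ℝ) - (n + 1)) := by
  rw [← (h.integral_trace_gram_inv hX hnp).2]
  refine integral_congr_ae ?_
  filter_upwards [h.ae_isUnit_det hX hnp] with ω hω
  rw [Matrix.trace_mul_comm, rightInv_transpose_mul_self hω]

/-- The trace pairing of two independent random matrices when the mean of the first is `c I`. -/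
theorem integral_trace_mul_of_indep {m₁ m₂ : MeasurableSpace Ω} (hind : Indep m₁ m₂ μ)
    {N C : Ω → Matrix (Fin p) (Fin p) ℝ} {c : ℝ}
    (hN : ∀ i j, Measurable[m₁] fun ω => N ω i j) (hNi : ∀ i j, Integrable (fun ω => N ω i j) μ)
    (hNc : ∀ i j, ∫ ω, N ω i j ∂μ = c * (1 : Matrix (Fin p) (Fin p) ℝ) i j)
    (hC : ∀ i j, Measurable[m₂] fun ω => C ω i j)
    (hCi : ∀ i j, Integrable (fun ω => C ω i j) μ) :
    Integrable (fun ω => (N ω * C ω).trace) μ ∧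
      ∫ ω, (N ω * C ω).trace ∂μ = c * ∫ ω, (C ω).trace ∂μ := by
  have hif : ∀ i j, IndepFun (fun ω => N ω i j) (fun ω => C ω j i) μ := fun i j =>
    indepFun_of_indep hind.symm (hN i j) (hC j i)
  have hint : ∀ i j, Integrable (fun ω => N ω i j * C ω j i) μ := fun i j =>
    (hif i j).integrable_mul (hNi i j) (hCi j i)
  have hval : ∀ i j, ∫ ω, N ω i j * C ω j i ∂μ
      = c * (1 : Matrix (Fin p) (Fin p) ℝ) i j * ∫ ω, C ω j i ∂μ := fun i j => by
    rw [← hNc]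
    exact (hif i j).integral_mul_eq_mul_integral (hNi i j).aestronglyMeasurable
      (hCi j i).aestronglyMeasurable
  simp only [Matrix.trace, Matrix.diag_apply, Matrix.mul_apply]
  refine ⟨integrable_finsetSum _ fun i _ => integrable_finsetSum _ fun j _ => hint i j, ?_⟩
  rw [integral_finsetSum _ fun i _ => integrable_finsetSum _ fun j _ => hint i j,
    integral_finsetSum _ fun i _ => hCi i i, Finset.mul_sum]
  refine Finset.sum_congr rfl fun i _ => ?_
  rw [integral_finsetSum _ fun j _ => hint i j, Finset.sum_eq_single i]
  · rw [hval]; simp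
  · intro j _ hj
    rw [hval, Matrix.one_apply_ne hj.symm]; simp
  · simp

variable [IsProbabilityMeasure μ]

theorem IsStdGaussianMatrix.memLp_rightInv_mul (h : IsStdGaussianMatrix μ X)
    (hX : ∀ i j, Measurable fun ω => X ω i j) (hnp : n + 1 < p) (i j : Fin p) (q : ENNReal) :
    MemLp (fun ω => (rightInv (X ω) * X ω) i j) q μ := by
  refine MemLp.of_bound (measurable_rightInv_mul_apply hX i j).aestronglyMeasurable 1 ?_
  filter_upwards [h.ae_isUnit_det hX hnp] with ω hω
  exact abs_rightInv_mul_le hω i j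

theorem IsStdGaussianMatrix.memLp_one_sub_rightInv_mul (h : IsStdGaussianMatrix μ X)
    (hX : ∀ i j, Measurable fun ω => X ω i j) (hnp : n + 1 < p) (i j : Fin p) (q : ENNReal) :
    MemLp (fun ω => (1 - rightInv (X ω) * X ω : Matrix (Fin p) (Fin p) ℝ) i j) q μ := by
  simp only [Matrix.sub_apply]
  exact (memLp_const _).sub (h.memLp_rightInv_mul hX hnp i j q)

theorem IsStdGaussianMatrix.integral_one_sub_rightInv_mul (h : IsStdGaussianMatrix μ X)
    (hX : ∀ i j, Measurable fun ω => X ω i j) (hnp : n + 1 < p) (i j : Fin p) :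
    ∫ ω, (1 - rightInv (X ω) * X ω : Matrix (Fin p) (Fin p) ℝ) i j ∂μ
      = ((p : ℝ) - n) / p * (1 : Matrix (Fin p) (Fin p) ℝ) i j := by
  have hp : (p : ℝ) ≠ 0 := by
    have : 0 < p := by omega
    positivity
  simp only [Matrix.sub_apply]
  rw [integral_sub (integrable_const _) ((h.memLp_rightInv_mul hX hnp i j 1).integrable le_rfl),
    h.integral_rightInv_mul hX hnp]
  simp
  field_simp

/-- The mean of a quadratic form in a fixed vector, for a random matrix with mean `c I`. -/
theorem integral_dotProduct_mulVec_self {N : Ω → Matrix (Fin p) (Fin p) ℝ} {c : ℝ}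
    (hNi : ∀ i j, MemLp (fun ω => N ω i j) 1 μ)
    (hNc : ∀ i j, ∫ ω, N ω i j ∂μ = c * (1 : Matrix (Fin p) (Fin p) ℝ) i j)
    (hN : ∀ i j, Measurable fun ω => N ω i j) (x : EuclideanSpace ℝ (Fin p)) :
    Integrable (fun ω => x.ofLp ⬝ᵥ (N ω *ᵥ x.ofLp)) μ ∧
      ∫ ω, x.ofLp ⬝ᵥ (N ω *ᵥ x.ofLp) ∂μ = c * ‖x‖ ^ 2 := by
  obtain ⟨h1, h2⟩ := integral_trace_mul_of_indep (c := c) (indep_bot_right mΩ (μ := μ))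
    (N := N) (C := fun _ => Matrix.vecMulVec x.ofLp x.ofLp) hN
    (fun i j => (hNi i j).integrable le_rfl) hNc (fun i j => measurable_const)
    (fun i j => integrable_const _)
  simp only [dotProduct_mulVec_eq_trace]
  refine ⟨h1, h2.trans ?_⟩
  rw [integral_const, EuclideanSpace.real_norm_sq_eq, Matrix.trace_vecMulVec]
  simp [dotProduct, sq]

theorem IsStdGaussianMatrix.memLp_sourceError (h : IsStdGaussianMatrix μ X)
    (hX : ∀ i j, Measurable fun ω => X ω i j) (hnp : n + 1 < p)
    (β δ : EuclideanSpace ℝ (Fin p)) (i : Fin p) :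
    MemLp (fun ω => sourceError (X ω) β δ i) 2 μ := by
  simp only [sourceError, Pi.sub_apply, Matrix.mulVec, dotProduct]
  exact (memLp_finsetSum _ fun j _ => (h.memLp_rightInv_mul hX hnp i j 2).mul_const _).sub
    (memLp_finsetSum _ fun j _ => (h.memLp_one_sub_rightInv_mul hX hnp i j 2).mul_const _)

theorem IsStdGaussianMatrix.integral_sourceError (h : IsStdGaussianMatrix μ X)
    (hX : ∀ i j, Measurable fun ω => X ω i j) (hnp : n + 1 < p)
    (β δ : EuclideanSpace ℝ (Fin p)) :
    ∫ ω, sourceError (X ω) β δ ⬝ᵥ sourceError (X ω) β δ ∂μ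
      = ((p : ℝ) - n) / p * ‖β‖ ^ 2 + (n : ℝ) / p * ‖δ‖ ^ 2 := by
  have hP := measurable_rightInv_mul_apply hX
  obtain ⟨h1, h2⟩ := integral_dotProduct_mulVec_self
    (fun i j => h.memLp_rightInv_mul hX hnp i j 1) (h.integral_rightInv_mul hX hnp) hP δ
  obtain ⟨h3, h4⟩ := integral_dotProduct_mulVec_self
    (fun i j => h.memLp_one_sub_rightInv_mul hX hnp i j 1)
    (h.integral_one_sub_rightInv_mul hX hnp) (fun i j => measurable_const.sub (hP i j)) β
  rw [← h2, ← h4, add_comm, ← integral_add h1 h3]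
  refine integral_congr_ae ?_
  filter_upwards [h.ae_isUnit_det hX hnp] with ω hω
  exact sourceError_dotProduct_self hω β δ

end RandomDesign

/-! ### Independence of designs and noises -/

section Sigma

variable {Ω : Type*}

theorem measurable_matrixSigma_apply {n p : ℕ} (X : Ω → Matrix (Fin n) (Fin p) ℝ) (i : Fin n)
    (j : Fin p) : Measurable[matrixSigma X] fun ω => X ω i j := by
  have h : Measurable[matrixSigma X] fun ω (i : Fin n) (j : Fin p) => X ω i j :=
    comap_measurable _
  exact (measurable_pi_apply j).comp ((measurable_pi_apply i).comp h)

theorem measurable_designSigma_apply {ι : Type*} {n : ι → ℕ} {p : ℕ}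
    (X : (k : ι) → Ω → Matrix (Fin (n k)) (Fin p) ℝ) (k : ι) (i : Fin (n k)) (j : Fin p) :
    Measurable[designSigma X] fun ω => X k ω i j :=
  (measurable_matrixSigma_apply (X k) i j).mono (le_iSup (fun k => matrixSigma (X k)) k) le_rfl

theorem measurable_iSup_vectorSigma_apply {ι : Type*} {n : ι → ℕ} (e : (k : ι) → Ω → Fin (n k) → ℝ)
    (k : ι) (i : Fin (n k)) : Measurable[⨆ k, vectorSigma (e k)] fun ω => e k ω i := by
  have h : Measurable[vectorSigma (e k)] (e k) := comap_measurable _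
  exact ((measurable_pi_apply i).comp h).mono (le_iSup (fun k => vectorSigma (e k)) k) le_rfl

variable [mΩ : MeasurableSpace Ω] {μ : Measure Ω}

theorem matrixSigma_le {n p : ℕ} {X : Ω → Matrix (Fin n) (Fin p) ℝ}
    (hX : ∀ i j, Measurable fun ω => X ω i j) : matrixSigma X ≤ mΩ :=
  (measurable_pi_lambda _ fun i => measurable_pi_lambda _ fun j => hX i j).comap_le

theorem indep_iSup_sum_elim {ι : Type*} {m₁ m₂ : ι → MeasurableSpace Ω}
    (h₁ : ∀ k, m₁ k ≤ mΩ) (h₂ : ∀ k, m₂ k ≤ mΩ) (h : iIndep (Sum.elim m₁ m₂) μ) :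
    Indep (⨆ k, m₂ k) (⨆ k, m₁ k) μ := by
  have hle : ∀ t, Sum.elim m₁ m₂ t ≤ mΩ := by
    rintro (k | k)
    · exact h₁ k
    · exact h₂ k
  have := indep_iSup_of_disjoint hle h (S := Set.range Sum.inr) (T := Set.range Sum.inl)
    Set.isCompl_range_inl_range_inr.disjoint.symm
  simpa only [iSup_range, Sum.elim_inl, Sum.elim_inr] using this

theorem IsNoise.integral_mul_self [IsProbabilityMeasure μ] {n : ℕ} {e : Ω → Fin n → ℝ} {s : ℝ}
    (h : IsNoise μ e s) (i : Fin n) : ∫ ω, e ω i * e ω i ∂μ = s ^ 2 := by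
  rw [← h.var i, variance_of_integral_eq_zero (h.memLp i).aestronglyMeasurable.aemeasurable
    (h.mean i)]
  simp only [sq]

theorem IsNoise.integral_mul_of_ne {n : ℕ} {e : Ω → Fin n → ℝ} {s : ℝ}
    (h : IsNoise μ e s) {i j : Fin n} (hij : i ≠ j) : ∫ ω, e ω i * e ω j ∂μ = 0 := by
  have := (h.indep.indepFun hij).integral_mul_eq_mul_integral (h.memLp i).aestronglyMeasurable
    (h.memLp j).aestronglyMeasurable
  rw [h.mean i, zero_mul] at this
  exact this

end Sigma

/-! ### Conditional bias and variance of the two interpolators -/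

section Estimators

variable {Ω : Type*} {m mε : MeasurableSpace Ω} [mΩ : MeasurableSpace Ω] {μ : Measure Ω}
  [IsProbabilityMeasure μ] {n₀ n₁ p : ℕ}
  {X₀ : Ω → Matrix (Fin n₀) (Fin p) ℝ} {X₁ : Ω → Matrix (Fin n₁) (Fin p) ℝ}
  {e₀ : Ω → Fin n₀ → ℝ} {e₁ : Ω → Fin n₁ → ℝ} {s₀ s₁ : ℝ}

/-- Conditionally on the designs the MNI has mean `H₀ β` and noise term `X₀† ε₀`. -/
theorem mni_affineInNoise (hm : m ≤ mΩ) (hind : Indep mε m μ)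
    (hX₀ : ∀ i j, Measurable[m] fun ω => X₀ ω i j) (h₀ : IsStdGaussianMatrix μ X₀)
    (hn₀ : n₀ + 1 < p) (he₀ : ∀ i, Measurable[mε] fun ω => e₀ ω i) (hs₀ : IsNoise μ e₀ s₀)
    (β : EuclideanSpace ℝ (Fin p)) :
    AffineInNoise μ m mε (fun ω => mni (X₀ ω) (response X₀ β e₀ ω))
      (fun ω => (rightInv (X₀ ω) * X₀ ω) *ᵥ β.ofLp) (fun ω => rightInv (X₀ ω)) e₀
      (fun _ => s₀) := by
  have hX₀' : ∀ i j, Measurable fun ω => X₀ ω i j := fun i j => (hX₀ i j).mono hm le_rfl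
  refine ⟨hind, fun i => ?_, fun i => ?_, fun i k => measurable_rightInv_apply hX₀ i k,
    fun i k => h₀.memLp_rightInv hX₀' hn₀ i k, he₀, hs₀.memLp, hs₀.mean, hs₀.integral_mul_self,
    fun k l hkl => hs₀.integral_mul_of_ne hkl, ?_⟩
  · simp only [Matrix.mulVec, dotProduct]
    exact Finset.measurable_sum _ fun j _ =>
      (measurable_rightInv_mul_apply hX₀ i j).mul_const _
  · simp only [Matrix.mulVec, dotProduct]
    exact integrable_finsetSum _ fun j _ =>
      ((h₀.memLp_rightInv_mul hX₀' hn₀ i j 1).integrable le_rfl).mul_const _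
  · filter_upwards [h₀.ae_isUnit_det hX₀' hn₀] with ω hω i
    exact congrFun (mni_response hω β (e₀ ω)) i

theorem measurable_one_sub_mul_rightInv_apply {Ω : Type*} {m : MeasurableSpace Ω}
    {X₀ : Ω → Matrix (Fin n₀) (Fin p) ℝ} {X₁ : Ω → Matrix (Fin n₁) (Fin p) ℝ}
    (hX₀ : ∀ i j, Measurable fun ω => X₀ ω i j)
    (hX₁ : ∀ i j, Measurable fun ω => X₁ ω i j) (i : Fin p) (k : Fin n₁) :
    Measurable fun ω =>
      ((1 - rightInv (X₀ ω) * X₀ ω) * rightInv (X₁ ω) : Matrix (Fin p) (Fin n₁) ℝ) i k :=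
  measurable_matrix_mul_apply (fun i j => by
    simp only [Matrix.sub_apply]
    exact measurable_const.sub (measurable_rightInv_mul_apply hX₀ i j))
    (measurable_rightInv_apply hX₁) i k

theorem memLp_one_sub_mul_rightInv_apply
    (hX₀ : ∀ i j, Measurable fun ω => X₀ ω i j) (h₀ : IsStdGaussianMatrix μ X₀)
    (hn₀ : n₀ + 1 < p) (hX₁ : ∀ i j, Measurable fun ω => X₁ ω i j)
    (h₁ : IsStdGaussianMatrix μ X₁) (hn₁ : n₁ + 1 < p) (i : Fin p) (k : Fin n₁) :
    MemLp (fun ω =>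
      ((1 - rightInv (X₀ ω) * X₀ ω) * rightInv (X₁ ω) : Matrix (Fin p) (Fin n₁) ℝ) i k) 2 μ := by
  simp only [Matrix.mul_apply]
  exact memLp_finsetSum _ fun j _ =>
    (h₁.memLp_rightInv hX₁ hn₁ j k).mul (p := ⊤) (h₀.memLp_one_sub_rightInv_mul hX₀ hn₀ i j ⊤)

/-- Conditionally on the designs the error of the transfer MNI is the source error projected onto
the null space of `X₀`, and the noises of both samples enter linearly; they are indexed jointly by
`Fin n₀ ⊕ Fin n₁`. -/
theorem transferMNI_affineInNoise (hm : m ≤ mΩ) (hind : Indep mε m μ)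
    (hX₀ : ∀ i j, Measurable[m] fun ω => X₀ ω i j) (h₀ : IsStdGaussianMatrix μ X₀)
    (hn₀ : n₀ + 1 < p) (he₀ : ∀ i, Measurable[mε] fun ω => e₀ ω i) (hs₀ : IsNoise μ e₀ s₀)
    (hX₁ : ∀ i j, Measurable[m] fun ω => X₁ ω i j) (h₁ : IsStdGaussianMatrix μ X₁)
    (hn₁ : n₁ + 1 < p) (he₁ : ∀ i, Measurable[mε] fun ω => e₁ ω i) (hs₁ : IsNoise μ e₁ s₁)
    (hind₀₁ : Indep (vectorSigma e₀) (vectorSigma e₁) μ)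
    (β₀ β₁ : EuclideanSpace ℝ (Fin p)) :
    AffineInNoise μ m mε
      (fun ω => transferMNI (X₀ ω) (response X₀ β₀ e₀ ω) (X₁ ω) (response X₁ β₁ e₁ ω))
      (fun ω => β₀.ofLp + (1 - rightInv (X₀ ω) * X₀ ω) *ᵥ sourceError (X₁ ω) β₀ (β₁ - β₀))
      (fun ω i => Sum.elim (rightInv (X₀ ω) i)
        (((1 - rightInv (X₀ ω) * X₀ ω) * rightInv (X₁ ω) : Matrix (Fin p) (Fin n₁) ℝ) i))
      (fun ω => Sum.elim (e₀ ω) (e₁ ω)) (Sum.elim (fun _ => s₀) (fun _ => s₁)) := by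
  have hX₀' : ∀ i j, Measurable fun ω => X₀ ω i j := fun i j => (hX₀ i j).mono hm le_rfl
  have hX₁' : ∀ i j, Measurable fun ω => X₁ ω i j := fun i j => (hX₁ i j).mono hm le_rfl
  have hcross : ∀ i j, ∫ ω, e₀ ω i * e₁ ω j ∂μ = 0 := by
    intro i j
    have hif : IndepFun (fun ω => e₀ ω i) (fun ω => e₁ ω j) μ :=
      ((IndepFun_iff_Indep _ _ _).2 hind₀₁).comp (measurable_pi_apply i) (measurable_pi_apply j)
    have := hif.integral_mul_eq_mul_integral (hs₀.memLp i).aestronglyMeasurable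
      (hs₁.memLp j).aestronglyMeasurable
    rw [hs₀.mean i, zero_mul] at this
    exact this
  refine ⟨hind, fun i => ?_, fun i => ?_, fun i => ?_, fun i => ?_, ?_, ?_, ?_, ?_, ?_, ?_⟩
  · simp only [Pi.add_apply, Matrix.mulVec, dotProduct, Matrix.sub_apply]
    exact measurable_const.add (Finset.measurable_sum _ fun j _ =>
      (measurable_const.sub (measurable_rightInv_mul_apply hX₀ i j)).mul
        (measurable_sourceError hX₁ _ _ j))
  · simp only [Pi.add_apply, Matrix.mulVec, dotProduct]
    exact (integrable_const _).add (integrable_finsetSum _ fun j _ =>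
      (h₀.memLp_one_sub_rightInv_mul hX₀' hn₀ i j 2).integrable_mul
        (h₁.memLp_sourceError hX₁' hn₁ _ _ j))
  · rintro (k | k)
    · exact measurable_rightInv_apply hX₀ i k
    · exact measurable_one_sub_mul_rightInv_apply hX₀ hX₁ i k
  · rintro (k | k)
    · exact h₀.memLp_rightInv hX₀' hn₀ i k
    · exact memLp_one_sub_mul_rightInv_apply hX₀' h₀ hn₀ hX₁' h₁ hn₁ i k
  · rintro (k | k)
    · exact he₀ k
    · exact he₁ k
  · rintro (k | k)
    · exact hs₀.memLp k
    · exact hs₁.memLp k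
  · rintro (k | k)
    · exact hs₀.mean k
    · exact hs₁.mean k
  · rintro (k | k)
    · exact hs₀.integral_mul_self k
    · exact hs₁.integral_mul_self k
  · rintro (k | k) (l | l) hkl
    · exact hs₀.integral_mul_of_ne fun h => hkl (by rw [h])
    · exact hcross k l
    · simp only [Sum.elim_inl, Sum.elim_inr, mul_comm (e₁ _ k)]
      exact hcross l k
    · exact hs₁.integral_mul_of_ne fun h => hkl (by rw [h])
  · filter_upwards [h₀.ae_isUnit_det hX₀' hn₀, h₁.ae_isUnit_det hX₁' hn₁] with ω hω₀ hω₁ i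
    have := congrFun (transferMNI_response hω₀ hω₁ β₀ β₁ (e₀ ω) (e₁ ω)) i
    rw [Fintype.sum_sum_type]
    exact this

/-- The noise contribution of the source is projected onto the null space of the target design. -/
theorem sum_sq_transfer {X₀ : Matrix (Fin n₀) (Fin p) ℝ} {X₁ : Matrix (Fin n₁) (Fin p) ℝ}
    (h₀ : IsUnit (X₀ * X₀ᵀ).det) :
    ∑ i, ∑ k, ((1 - rightInv X₀ * X₀) * rightInv X₁ : Matrix (Fin p) (Fin n₁) ℝ) i k ^ 2
      = ((1 - rightInv X₀ * X₀) * (rightInv X₁ * (rightInv X₁)ᵀ)).trace := by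
  rw [sum_sq_eq_trace, Matrix.transpose_mul, one_sub_rightInv_mul_transpose,
    Matrix.mul_assoc, Matrix.trace_mul_comm, Matrix.mul_assoc, Matrix.mul_assoc,
    one_sub_rightInv_mul_idem h₀, ← Matrix.mul_assoc, Matrix.trace_mul_comm]

end Estimators

end TransferMNI

end

open TransferMNI in
theorem theorem1 {Ω : Type*} [MeasurableSpace Ω] (μ : Measure Ω) [IsProbabilityMeasure μ]
    (Q p : ℕ) (n : Fin (Q + 1) → ℕ) (q : Fin (Q + 1)) (hq : q ≠ 0)
    (hp₀ : n 0 + 1 < p) (hpq : n q + 1 < p)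
    (β : Fin (Q + 1) → EuclideanSpace ℝ (Fin p)) (σ : Fin (Q + 1) → ℝ)
    (X : (k : Fin (Q + 1)) → Ω → Matrix (Fin (n k)) (Fin p) ℝ)
    (ε : (k : Fin (Q + 1)) → Ω → Fin (n k) → ℝ)
    (hX : ∀ k i j, Measurable fun ω => X k ω i j)
    (hε : ∀ k, Measurable (ε k))
    (hindep : iIndep (Sum.elim (fun k => matrixSigma (X k)) (fun k => vectorSigma (ε k))) μ)
    (hX₀ : IsStdGaussianMatrix μ (X 0)) (hXq : IsStdGaussianMatrix μ (X q))
    (hnoise : ∀ k, IsNoise μ (ε k) (σ k))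
    (y : (k : Fin (Q + 1)) → Ω → Fin (n k) → ℝ)
    (hy : ∀ k, y k = response (X k) (β k) (ε k))
    (bM bTM : Ω → EuclideanSpace ℝ (Fin p))
    (hbM : bM = fun ω => mni (X 0 ω) (y 0 ω))
    (hbTM : bTM = fun ω => transferMNI (X 0 ω) (y 0 ω) (X q ω) (y q ω))
    (BM VM BTM VTM Vinf : Ω → ℝ)
    (hBM : BM = bias μ (designSigma X) 1 (β 0) bM)
    (hVM : VM = condVariance μ (designSigma X) 1 bM)
    (hBTM : BTM = bias μ (designSigma X) 1 (β 0) bTM)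
    (hVTM : VTM = condVariance μ (designSigma X) 1 bTM)
    (hVinf : Vinf = fun ω => varInflation 1 (X 0 ω) (X q ω) (σ q)) :
    -- the conditional bias and variance have the closed forms in the designs
    ((∀ᵐ ω ∂μ, BM ω = biasMNI 1 (X 0 ω) (β 0)) ∧
     (∀ᵐ ω ∂μ, VM ω = varMNI 1 (X 0 ω) (σ 0)) ∧
     (∀ᵐ ω ∂μ, BTM ω = biasTM 1 (X 0 ω) (X q ω) (β 0) (β q - β 0)) ∧
     (∀ᵐ ω ∂μ, VTM ω = Vinf ω + VM ω)) ∧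
    -- their expectations over the designs
    (Integrable BM μ ∧ ∫ ω, BM ω ∂μ = ((p : ℝ) - n 0) / p * ‖β 0‖ ^ 2) ∧
    (Integrable BTM μ ∧ ∫ ω, BTM ω ∂μ =
      ((p : ℝ) - n 0) / p *
        (((p : ℝ) - n q) / p * ‖β 0‖ ^ 2 + (n q : ℝ) / p * ‖β q - β 0‖ ^ 2)) ∧
    (Integrable VM μ ∧ ∫ ω, VM ω ∂μ = σ 0 ^ 2 * n 0 / ((p : ℝ) - (n 0 + 1))) ∧
    (Integrable Vinf μ ∧ ∫ ω, Vinf ω ∂μ =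
      ((p : ℝ) - n 0) / p * (σ q ^ 2 * n q / ((p : ℝ) - (n q + 1)))) ∧
    (Integrable VTM μ ∧ ∫ ω, VTM ω ∂μ =
      ((p : ℝ) - n 0) / p * (σ q ^ 2 * n q / ((p : ℝ) - (n q + 1))) + ∫ ω, VM ω ∂μ) := by
  obtain rfl : y = fun k => response (X k) (β k) (ε k) := funext hy
  subst hbM hbTM hBM hVM hBTM hVTM hVinf
  have hXle : ∀ k, matrixSigma (X k) ≤ ‹MeasurableSpace Ω› := fun k => matrixSigma_le (hX k)
  have hεle : ∀ k, vectorSigma (ε k) ≤ ‹MeasurableSpace Ω› := fun k => (hε k).comap_le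
  have hm : designSigma X ≤ ‹MeasurableSpace Ω› := iSup_le hXle
  have hmε : (⨆ k, vectorSigma (ε k)) ≤ ‹MeasurableSpace Ω› := iSup_le hεle
  have hind : Indep (⨆ k, vectorSigma (ε k)) (designSigma X) μ :=
    indep_iSup_sum_elim hXle hεle hindep
  have hindX : Indep (matrixSigma (X 0)) (matrixSigma (X q)) μ :=
    hindep.indep (i := Sum.inl 0) (j := Sum.inl q) (by simpa using hq.symm)
  have hindε : Indep (vectorSigma (ε 0)) (vectorSigma (ε q)) μ :=
    hindep.indep (i := Sum.inr 0) (j := Sum.inr q) (by simpa using hq.symm)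
  have hU₀ := hX₀.ae_isUnit_det (hX 0) hp₀
  have hUq := hXq.ae_isUnit_det (hX q) hpq
  have hM := mni_affineInNoise hm hind (measurable_designSigma_apply X 0) hX₀ hp₀
    (measurable_iSup_vectorSigma_apply ε 0) (hnoise 0) (β 0)
  have hTM := transferMNI_affineInNoise hm hind (measurable_designSigma_apply X 0) hX₀ hp₀
    (measurable_iSup_vectorSigma_apply ε 0) (hnoise 0) (measurable_designSigma_apply X q) hXq hpq
    (measurable_iSup_vectorSigma_apply ε q) (hnoise q) hindε (β 0) (β q)
  -- `N = I - H₀` has mean `(p - n₀) / p • I` and is independent of the source design, so that both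
  -- `BTM` and `Vinf` are traces `tr (N C)` with `C` a function of `X q`.
  have hNm : ∀ i j, Measurable[matrixSigma (X 0)]
      fun ω => (1 - rightInv (X 0 ω) * X 0 ω : Matrix (Fin p) (Fin p) ℝ) i j := fun i j => by
    simp only [Matrix.sub_apply]
    exact measurable_const.sub
      (measurable_rightInv_mul_apply (measurable_matrixSigma_apply (X 0)) i j)
  have hNi := fun i j => hX₀.memLp_one_sub_rightInv_mul (hX 0) hp₀ i j 1
  have hNc := hX₀.integral_one_sub_rightInv_mul (hX 0) hp₀
  have hBM : ∀ᵐ ω ∂μ, bias μ (designSigma X) 1 (β 0)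
      (fun ω => mni (X 0 ω) (response (X 0) (β 0) (ε 0) ω)) ω
        = (β 0).ofLp ⬝ᵥ ((1 - rightInv (X 0 ω) * X 0 ω) *ᵥ (β 0).ofLp) := by
    filter_upwards [hM.bias_ae hm hmε (β 0), hU₀] with ω h hω
    rw [h, ← dotProduct_mulVec_self_of_symm_idem (one_sub_rightInv_mul_transpose (X 0 ω))
      (one_sub_rightInv_mul_idem hω), Matrix.sub_mulVec, Matrix.one_mulVec, ← neg_sub,
      neg_dotProduct_neg]
  obtain ⟨hBMi, hBMv⟩ := integral_dotProduct_mulVec_self hNi hNc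
    (fun i j => (hNm i j).mono (hXle 0) le_rfl) (β 0)
  have hBTM : ∀ᵐ ω ∂μ, bias μ (designSigma X) 1 (β 0)
      (fun ω => transferMNI (X 0 ω) (response (X 0) (β 0) (ε 0) ω) (X q ω)
        (response (X q) (β q) (ε q) ω)) ω
        = sourceError (X q ω) (β 0) (β q - β 0) ⬝ᵥ
          ((1 - rightInv (X 0 ω) * X 0 ω) *ᵥ sourceError (X q ω) (β 0) (β q - β 0)) := by
    filter_upwards [hTM.bias_ae hm hmε (β 0), hU₀] with ω h hω
    rw [h, add_sub_cancel_left,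
      dotProduct_mulVec_self_of_symm_idem (one_sub_rightInv_mul_transpose (X 0 ω))
        (one_sub_rightInv_mul_idem hω)]
  obtain ⟨hBTMi, hBTMv⟩ := integral_trace_mul_of_indep hindX hNm
    (fun i j => (hNi i j).integrable le_rfl) hNc
    (C := fun ω => Matrix.vecMulVec (sourceError (X q ω) (β 0) (β q - β 0))
      (sourceError (X q ω) (β 0) (β q - β 0)))
    (fun i j => (measurable_sourceError (measurable_matrixSigma_apply (X q)) _ _ i).mul
      (measurable_sourceError (measurable_matrixSigma_apply (X q)) _ _ j))
    (fun i j => (hXq.memLp_sourceError (hX q) hpq _ _ i).integrable_mul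
      (hXq.memLp_sourceError (hX q) hpq _ _ j))
  simp only [← dotProduct_mulVec_eq_trace, Matrix.trace_vecMulVec] at hBTMi hBTMv
  rw [hXq.integral_sourceError (hX q) hpq] at hBTMv
  have hVM : ∀ᵐ ω ∂μ, condVariance μ (designSigma X) 1
      (fun ω => mni (X 0 ω) (response (X 0) (β 0) (ε 0) ω)) ω
        = σ 0 ^ 2 * ((X 0 ω * (X 0 ω)ᵀ)⁻¹).trace := by
    filter_upwards [hM.condVariance_ae hm hmε, hU₀] with ω h hω
    rw [h, ← rightInv_transpose_mul_self hω, Matrix.trace_mul_comm, ← sum_sq_eq_trace]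
    simp only [Finset.mul_sum]
  obtain ⟨hVMi, hVMv⟩ := hX₀.integral_trace_gram_inv (hX 0) hp₀
  have hVinf : ∀ᵐ ω ∂μ, varInflation 1 (X 0 ω) (X q ω) (σ q)
      = σ q ^ 2 * ((1 - rightInv (X 0 ω) * X 0 ω) *
          (rightInv (X q ω) * (rightInv (X q ω))ᵀ)).trace := by
    filter_upwards [hU₀, hUq] with ω h₀ h₁
    exact varInflation_one h₀ h₁ _
  have hrI := measurable_rightInv_apply (measurable_matrixSigma_apply (X q))
  obtain ⟨hIi, hIv⟩ := integral_trace_mul_of_indep hindX hNm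
    (fun i j => (hNi i j).integrable le_rfl) hNc
    (C := fun ω => rightInv (X q ω) * (rightInv (X q ω))ᵀ)
    (fun i j => measurable_matrix_mul_apply hrI (fun i j => hrI j i) i j)
    (hXq.integrable_rightInv_mul_transpose (hX q) hpq)
  rw [hXq.integral_trace_rightInv_mul_transpose (hX q) hpq] at hIv
  have hVTM : ∀ᵐ ω ∂μ, condVariance μ (designSigma X) 1
      (fun ω => transferMNI (X 0 ω) (response (X 0) (β 0) (ε 0) ω) (X q ω)
        (response (X q) (β q) (ε q) ω)) ω
        = varInflation 1 (X 0 ω) (X q ω) (σ q) + condVariance μ (designSigma X) 1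
          (fun ω => mni (X 0 ω) (response (X 0) (β 0) (ε 0) ω)) ω := by
    filter_upwards [hTM.condVariance_ae hm hmε, hM.condVariance_ae hm hmε, hVinf, hU₀]
      with ω h1 h2 h3 hω
    rw [h1, h2, h3, ← sum_sq_transfer hω]
    simp only [Fintype.sum_sum_type, Sum.elim_inl, Sum.elim_inr, Finset.sum_add_distrib,
      Finset.mul_sum]
    ring
  have hVMi' := (hVMi.const_mul (σ 0 ^ 2)).congr (hVM.mono fun ω h => h.symm)
  have hVinfi := (hIi.const_mul (σ q ^ 2)).congr (hVinf.mono fun ω h => h.symm)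
  have hVinfv : ∫ ω, varInflation 1 (X 0 ω) (X q ω) (σ q) ∂μ
      = ((p : ℝ) - n 0) / p * (σ q ^ 2 * n q / ((p : ℝ) - (n q + 1))) := by
    rw [integral_congr_ae hVinf, integral_const_mul, hIv]; ring
  refine ⟨⟨?_, ?_, ?_, hVTM⟩, ⟨hBMi.congr (hBM.mono fun ω h => h.symm), ?_⟩,
    ⟨hBTMi.congr (hBTM.mono fun ω h => h.symm), ?_⟩, ⟨hVMi', ?_⟩, ⟨hVinfi, hVinfv⟩,
    ⟨(hVinfi.add hVMi').congr (hVTM.mono fun ω h => h.symm), ?_⟩⟩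
  · filter_upwards [hBM, hU₀] with ω h hω
    rw [h, biasMNI_one hω]
  · filter_upwards [hVM, hU₀] with ω h hω
    rw [h, varMNI_one hω]
  · filter_upwards [hBTM, hU₀, hUq] with ω h h₀ h₁
    rw [h, biasTM_one h₀ h₁]
  · rw [integral_congr_ae hBM, hBMv]
  · rw [integral_congr_ae hBTM, hBTMv]
  · rw [integral_congr_ae hVM, integral_const_mul, hVMv]; ring
  · rw [integral_congr_ae hVTM, integral_add hVinfi hVMi', hVinfv]
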